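/- **Notation.** For $n\ge 1$ let $W_n=\mathrm{Aut}(T_n)$ be the automorphism group of the complete binary rooted tree of height $n$, acting on its $2^n$ leaves $1,\dots,2^n$, numbered from left to right. Permutations are composed from right to left, $g^w=wgw^{-1}$, and for $i\le n$ we regard $W_i\le W_n$ by letting $W_i$ act on the leaves $1,\dots,2^i$ and fix all other leaves. Let $a_k=\prod_{j=1}^{2^{k-1}}(j,\,j+2^{k-1})$ and $x_k=a_1a_2\cdots a_k$. An $n$-odometer is an element $w\in W_n$ such that $\langle w\rangle$ is transitive on the leaves, and for $G\le W_n$ we put $G^{od}=\{g\in G: x_ng\text{ is an }n\text{-odometer}\}$. **The groups.** Let $m_1=\mathrm{id}\in W_1$ and $m_2=(1,2)\in W_2$, where the cycles $(1,2),(3),(4)$ of $m_2$ carry the types $sn,ss,ss$. The element $m_{n+1}$ is obtained from $m_n$ ($n\ge 2$) by replacing each typed cycle $(c_1,\dots,c_k)$ as follows. Type $nn$: one cycle $(2c_1-1,\dots,2c_k-1,2c_1,\dots,2c_k)$ of type $nn$. Type $ns$: the same cycle with type $sn$. Type $sn$: the cycles $(2c_1-1,\dots,2c_k-1)$ of type $nn$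 and $(2c_1,\dots,2c_k)$ of type $sn$. Type $ss$: the same two cycles, both of type $ss$. (Cycles are written starting from their smallest entry.) In $W_n$ put $$M_n=\langle x_n,m_n,x_{n-1}^2,\dots,x_2^2\rangle,\qquad H_n=\langle m_n,x_{n-1}^2,\dots,x_2^2\rangle$$ (for $n\le 2$ there are no $x_i^2$), let $N_n$ be the normal closure of $H_n$ in $M_n$, and let $$M_n(2)=\langle x_n^2,\;x_nm_n,\;N_n^{od}\rangle .$$ **The model.** Let $h_a(x)=(x+a)^2-a-1\in\mathbb Z[x]$ be irreducible with $a=\pm b^2$ for some $b\in\mathbb Z$. The post-critical orbit of $h_a$ is $(-a-1,-a)$, and its critical point is periodic. Model 6, the even Markov model of $h_a$, is the following. Its level $1$ data are $$([sn,2],\tfrac12),\ ([nn,1][nn,1],\tfrac18),\ ([ns,1][ns,1],\tfrac18),\ ([sn,1][sn,1],\tfrac18),\ ([ss,1][ss,1],\tfrac18).$$ Its level $n+1$ data arise from its level $n$ data by one step of the Markov process of $h_a$, in which the factors $[T,d]$ of a formal product evolve independently of each other: a factor whose type $T$ starts with $n$ becomes $[h_a(T),2d]$, where $h_a(T)$ is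 the type $T$ with its two letters exchanged; a factor whose type $T$ starts with $s$ becomes $[T_1,d][T_2,d]$, where all pairs of types with $T_1T_2=h_a(T)$ (entrywise product, with $s$ as the identity and $n\cdot n=s$) and with equal last letters are equiprobable. Explicitly, $$[nn,d]\to[nn,2d],\qquad [ns,d]\to[sn,2d],$$ $$[sn,d]\to[ns,d][ss,d]\ \text{or}\ [nn,d][sn,d],$$ $$[ss,d]\to[nn,d]^2\ \text{or}\ [ns,d]^2\ \text{or}\ [sn,d]^2\ \text{or}\ [ss,d]^2 .$$ **Corollary 6.28.** For every $n\ge1$, $M_n(2)$ is a subgroup of $\mathrm{Aut}(T_n)$ that satisfies Model 6: for every partition $c$ of $2^n$, the proportion of elements of $M_n(2)$ with cycle type $c$ (including $1$-cycles) equals the sum of the densities of the level $n$ data whose multiset of degrees is $c$. -/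

import Mathlib

namespace MarkovModel

open Polynomial

/-! ## Types of factors and the Markov process of a quadratic polynomial -/

/-- The two letters of types: `s` for "square", `n` for "not a square". -/
inductive Letter
  | n
  | s
  deriving DecidableEq

namespace Letter

/-- Multiplication of quadratic characters. -/
def mul : Letter → Letter → Letter
  | s, b => b
  | n, n => s
  | n, s => n

end Letter

open Letter

/-- A type: a string of letters (its length is the size of the post-critical orbit). -/
abbrev Typ := List Letter

/-- All types of a given length. -/
def allTypes : ℕ → List Typ
  | 0 => [[]]
  | o + 1 => (allTypes o).flatMap fun T => [n :: T, s :: T]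

/-- Entrywise product of types. -/
def mulTyp (T₁ T₂ : Typ) : Typ := List.zipWith Letter.mul T₁ T₂

/-- The `i`-th digit of a type; digits are numbered `1, 2, …`. -/
def digit (T : Typ) (i : ℕ) : Letter := T.getD (i - 1) s

/-- The critical point of a quadratic polynomial. -/
noncomputable def criticalPoint (f : ℤ[X]) : ℚ := -(f.coeff 1 : ℚ) / (2 * (f.coeff 2 : ℚ))

/-- `f^k(c)`, where `c` is the critical point of `f`. -/
noncomputable def criticalIterate (f : ℤ[X]) (k : ℕ) : ℚ :=
  (fun y : ℚ => aeval y f)^[k] (criticalPoint f)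

/-- The post-critical orbit `{f(c), f²(c), …}`. -/
def postCriticalOrbit (f : ℤ[X]) : Set ℚ := {y | ∃ k, 1 ≤ k ∧ y = criticalIterate f k}

/-- The tail of the post-critical orbit: the points that are visited exactly once. -/
def postCriticalTail (f : ℤ[X]) : Set ℚ :=
  {y | ∃ k, 1 ≤ k ∧ y = criticalIterate f k ∧
    ∀ i, i ≠ k → criticalIterate f i ≠ criticalIterate f k}

/-- The number `o`: the size of the post-critical orbit. -/
noncomputable def orbitSize (f : ℤ[X]) : ℕ := (postCriticalOrbit f).ncard

/-- The number `t`: the size of the tail; the critical point is periodic iff `t = 0`. -/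
noncomputable def tailSize (f : ℤ[X]) : ℕ := (postCriticalTail f).ncard

/-- The integer `m ∈ {1, …, o}` with `f^(o+1)(c) = f^m(c)`. -/
noncomputable def returnIndex (f : ℤ[X]) : ℕ :=
  sInf {m | 1 ≤ m ∧ criticalIterate f (orbitSize f + 1) = criticalIterate f m}

/-- The action of `f` on types: shift one position to the left and append the `m`-th digit,
where `f^(o+1)(c) = f^m(c)`. -/
noncomputable def actTyp (f : ℤ[X]) (T : Typ) : Typ := T.tail ++ [digit T (returnIndex f)]

/-- The index `k` in the constraint on the types of two siblings: `k = o` if the critical point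
is periodic, and `k = t` otherwise. -/
noncomputable def siblingIndex (f : ℤ[X]) : ℕ :=
  if tailSize f = 0 then orbitSize f else tailSize f

/-- The allowable pairs of types of the two children of a factor of type `T`: the product of
the two types is `f(T)`, and, with `k` the sibling index, the last digit of each of the two types
is the `k`-th digit of the other. -/
noncomputable def allowablePairs (f : ℤ[X]) (T : Typ) : List (Typ × Typ) :=
  ((allTypes (orbitSize f)).product (allTypes (orbitSize f))).filter fun P =>
    mulTyp P.1 P.2 = actTyp f T ∧
    digit P.1 (orbitSize f) = digit P.2 (siblingIndex f) ∧
    digit P.2 (orbitSize f) = digit P.1 (siblingIndex f)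

/-- A formal product `∏ [tᵢ, dᵢ]`: a list of factors with their types and degrees. -/
abbrev FactorizationType := List (Typ × ℕ)

/-- A collection of data: factorization types, each with its density. -/
abbrev Data := List (FactorizationType × ℚ)

/-- The possible families of children of one factor (primes `≡ 1 mod 4`): one child of twice the
degree if the type starts with `n`, two children of the same degree with an allowable pair of
types if it starts with `s`. -/
noncomputable def childrenOptions (f : ℤ[X]) : Typ × ℕ → List FactorizationType
  | (n :: T, d) => [[(actTyp f (n :: T), 2 * d)]]
  | (s :: T, d) => (allowablePairs f (s :: T)).map fun P => [(P.1, d), (P.2, d)]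
  | ([], _) => []

/-- All possible families of children of one factor are equiprobable. -/
noncomputable def childrenData (f : ℤ[X]) (g : Typ × ℕ) : Data :=
  (childrenOptions f g).map fun C => (C, 1 / ((childrenOptions f g).length : ℚ))

/-- One step of the Markov process on a factorization type: the factors evolve independently. -/
noncomputable def stepType (f : ℤ[X]) : FactorizationType → Data
  | [] => [([], 1)]
  | g :: D => (childrenData f g).flatMap fun C =>
      (stepType f D).map fun E => (C.1 ++ E.1, C.2 * E.2)

/-- One step of the Markov process, from level `n` data to level `n + 1` data. -/
noncomputable def stepData (f : ℤ[X]) (A : Data) : Data :=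
  A.flatMap fun D => (stepType f D.1).map fun E => (E.1, D.2 * E.2)

/-- The level `n` data, `n ≥ 1`, obtained from level `1` data `A` by `n - 1` steps of the
Markov process. -/
noncomputable def levelData (f : ℤ[X]) (A : Data) (n : ℕ) : Data := (stepData f)^[n - 1] A

/-- The cycle type (multiset of degrees) of a factorization type. -/
def degrees (D : FactorizationType) : Multiset ℕ := (D.map Prod.snd : List ℕ)

/-- The cycle data of a collection of data: the density of the cycle type `c` is the sum of the
densities of all data with that cycle type. -/
def cycleDensity (A : Data) (c : Multiset ℕ) : ℚ :=
  ((A.filter fun D => degrees D.1 = c).map Prod.snd).sum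

/-! ## The automorphism group of the binary tree of height `n`, acting on its `2 ^ n` leaves

Leaves are numbered `0, …, 2 ^ n - 1` from left to right; the ancestor at height `j` above the
leaf `i` is determined by `i / 2 ^ j`. -/

/-- Permutations of the leaves. -/
abbrev LeafPerm (n : ℕ) := Equiv.Perm (Fin (2 ^ n))

/-- `W_n = Aut(T_n)`: the permutations of the leaves such that, for each height `j`, two leaves
have the same ancestor iff their images do. -/
def treeAut (n : ℕ) : Subgroup (LeafPerm n) where
  carrier := {g | ∀ (j : ℕ) (i i' : Fin (2 ^ n)),
    (g i : ℕ) / 2 ^ j = (g i' : ℕ) / 2 ^ j ↔ (i : ℕ) / 2 ^ j = (i' : ℕ) / 2 ^ j}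
  one_mem' := fun _ _ _ => Iff.rfl
  mul_mem' := fun {_ b} ha hb j i i' => (ha j (b i) (b i')).trans (hb j i i')
  inv_mem' := fun {a} ha j i i' => by
    have h := ha j (a⁻¹ i) (a⁻¹ i')
    simp only [← Equiv.Perm.mul_apply, mul_inv_cancel, Equiv.Perm.one_apply] at h
    exact h.symm

/-- The cycle type of a permutation of the leaves, including its `1`-cycles. -/
def cycleTypeFull {n : ℕ} (g : LeafPerm n) : Multiset ℕ := g.partition.parts

/-- The proportion of elements of `G` with cycle type `c`. -/
noncomputable def groupCycleDensity {n : ℕ} (G : Subgroup (LeafPerm n)) (c : Multiset ℕ) : ℚ :=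
  (Nat.card {g : LeafPerm n // g ∈ G ∧ cycleTypeFull g = c} : ℚ) / (Nat.card G : ℚ)

/-- `G ≤ Aut(T_n)`, and the cycle data of `G` are the level `n` cycle data of the even Markov
model of `f` with level `1` data `A`. -/
def SatisfiesEvenMarkovModel (f : ℤ[X]) (A : Data) (n : ℕ) (G : Subgroup (LeafPerm n)) : Prop :=
  G ≤ treeAut n ∧ ∀ c : Multiset ℕ, groupCycleDensity G c = cycleDensity (levelData f A n) c

/-- The underlying map of `a_k`, on all natural numbers. -/
def aFun (k i : ℕ) : ℕ :=
  if i < 2 ^ (k - 1) then i + 2 ^ (k - 1) else if i < 2 * 2 ^ (k - 1) then i - 2 ^ (k - 1) else i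

theorem aFun_aFun (k i : ℕ) : aFun k (aFun k i) = i := by
  unfold aFun
  split_ifs <;> omega

theorem aFun_lt {n k i : ℕ} (hk : 1 ≤ k) (hkn : k ≤ n) (hi : i < 2 ^ n) : aFun k i < 2 ^ n := by
  have h : 2 * 2 ^ (k - 1) ≤ 2 ^ n := by
    calc 2 * 2 ^ (k - 1) = 2 ^ (k - 1 + 1) := by ring
      _ ≤ 2 ^ n := Nat.pow_le_pow_right (by norm_num) (by omega)
  unfold aFun
  split_ifs <;> omega

/-- `a_k ∈ W_n`, for `1 ≤ k ≤ n`: it swaps the leaves `i` and `i + 2 ^ (k - 1)` for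
`0 ≤ i < 2 ^ (k - 1)` and fixes all other leaves. (It is the identity for other `k`.) -/
def a (n k : ℕ) : LeafPerm n :=
  if h : 1 ≤ k ∧ k ≤ n then
    { toFun := fun i => ⟨aFun k i, aFun_lt h.1 h.2 i.2⟩
      invFun := fun i => ⟨aFun k i, aFun_lt h.1 h.2 i.2⟩
      left_inv := fun i => Fin.ext (aFun_aFun k i)
      right_inv := fun i => Fin.ext (aFun_aFun k i) }
  else 1

/-- `x_k = a_1 a_2 ⋯ a_k`, as an element of `W_n` for `k ≤ n`. -/
def x (n k : ℕ) : LeafPerm n := ((List.range k).map fun i => a n (i + 1)).prod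

/-- An `n`-odometer: an element of `W_n` that generates a group acting transitively on the leaves
(hence on every level of `T_n`). -/
def IsOdometer {n : ℕ} (w : LeafPerm n) : Prop := w ∈ treeAut n ∧ ∀ i j, w.SameCycle i j

/-- `G^od = {g ∈ G | x_n g is an n-odometer}`. -/
def od {n : ℕ} (G : Subgroup (LeafPerm n)) : Set (LeafPerm n) :=
  {g | g ∈ G ∧ IsOdometer (x n n * g)}

/-! ## The element `m_n`, by the Markov map of a restricted Markov process -/

/-- The restricted Markov process: the types of the child (one entry) or of the two children (two
entries), for `nn → nn`, `ns → sn`, `sn → nn, sn`, `ss → ss, ss`. -/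
def restricted : Typ → List Typ
  | [n, n] => [[n, n]]
  | [n, s] => [[s, n]]
  | [s, n] => [[n, n], [s, n]]
  | [s, s] => [[s, s], [s, s]]
  | _ => []

/-- A cycle of leaves (written as a list) with a type attached. -/
abbrev TypedCycle (n : ℕ) := List (Fin (2 ^ n)) × Typ

/-- The left child of the leaf `i` of `T_n`, as a leaf of `T_{n+1}`. -/
def leftChild {n : ℕ} (i : Fin (2 ^ n)) : Fin (2 ^ (n + 1)) :=
  ⟨2 * i, by have := i.2; rw [pow_succ]; omega⟩

/-- The right child of the leaf `i` of `T_n`, as a leaf of `T_{n+1}`. -/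
def rightChild {n : ℕ} (i : Fin (2 ^ n)) : Fin (2 ^ (n + 1)) :=
  ⟨2 * i + 1, by have := i.2; rw [pow_succ]; omega⟩

/-- The Markov map on one typed cycle `c`: the standard doubling
`(left c₁, …, left c_k, right c₁, …, right c_k)` if there is one child, and the standard splitting
`(left c₁, …, left c_k)(right c₁, …, right c_k)` if there are two. -/
def markovMapCycle {n : ℕ} (c : TypedCycle n) : List (TypedCycle (n + 1)) :=
  match restricted c.2 with
  | [T] => [(c.1.map leftChild ++ c.1.map rightChild, T)]
  | [T₁, T₂] => [(c.1.map leftChild, T₁), (c.1.map rightChild, T₂)]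
  | _ => []

/-- The typed cycle decomposition of `m_{k+2}`: the Markov map applied `k` times to
`m_2 = (0 1)(2)(3)` with the types `[sn,2][ss,1][ss,1]`. -/
def mCycles : (k : ℕ) → List (TypedCycle (k + 2))
  | 0 => [([(0 : Fin 4), (1 : Fin 4)], [s, n]), ([(2 : Fin 4)], [s, s]), ([(3 : Fin 4)], [s, s])]
  | k + 1 => (mCycles k).flatMap markovMapCycle

/-- The element `m_n` of `W_n`; `m_1` is the identity. -/
def m : (n : ℕ) → LeafPerm n
  | 0 => 1
  | 1 => 1
  | k + 2 => ((mCycles k).map fun c => c.1.formPerm).prod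

/-! ## The groups -/

/-- `{v_0, …, v_{n-3}} = {x_2², …, x_{n-1}²}`, in `W_n` (empty for `n ≤ 2`). -/
def vSet (n : ℕ) : Set (LeafPerm n) := {g | ∃ i, i + 3 ≤ n ∧ g = x n (i + 2) ^ 2}

/-- `M_n = ⟨x_n, m_n, v_{n-3}, …, v_0⟩`. -/
def M (n : ℕ) : Subgroup (LeafPerm n) := Subgroup.closure ({x n n, m n} ∪ vSet n)

/-- `H_n = ⟨m_n, v_{n-3}, …, v_0⟩`. -/
def H (n : ℕ) : Subgroup (LeafPerm n) := Subgroup.closure ({m n} ∪ vSet n)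

/-- `N_n`, the normal closure of `H_n` in `M_n`. -/
def N (n : ℕ) : Subgroup (LeafPerm n) :=
  Subgroup.closure {y | ∃ g ∈ M n, ∃ h ∈ H n, y = g * h * g⁻¹}

/-- `M_n(2) = ⟨x_n², x_n m_n, N_n^od⟩`. -/
def M2 (n : ℕ) : Subgroup (LeafPerm n) :=
  Subgroup.closure ({x n n ^ 2, x n n * m n} ∪ od (N n))

/-! ## The polynomials and the level one data -/

/-- `h_a = (x + a)² - a - 1`. -/
noncomputable def h (a : ℤ) : ℤ[X] := (X + C a) ^ 2 - C a - 1

/-- The level `1` data of Model 6. -/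
def model6 : Data :=
  [([([s, n], 2)], 1 / 2),
   ([([n, n], 1), ([n, n], 1)], 1 / 8),
   ([([n, s], 1), ([n, s], 1)], 1 / 8),
   ([([s, n], 1), ([s, n], 1)], 1 / 8),
   ([([s, s], 1), ([s, s], 1)], 1 / 8)]

end MarkovModel

/-!
Write an element of `W_{n+1}` as `(u, v) σ ^ s`, where `σ` exchanges the two halves of the leaves
and `u`, `v ∈ W_n` act on them. Define types in `(ℤ/2)²`, with `0` and `1` in the roles of the
letters `s` and `n`: `(u, v) σ ^ s` has type `(s, t)` if `u` and `v` have types with sum `(t, s)`.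
The typed permutations form a group, types are additive, and `M_n(2)` is the group of those whose
last letter is `0`.

Consider the average, over the permutations of a given type, of the formal monomial that records
the cycle type. For first letter `0` it is the mean of the products of the averages for the allowed
pairs of types one level below. For first letter `1` the cycles of `(u, v) σ` are those of `u v`
with their lengths doubled, so it is the doubling of the average for the exchanged type. The
generating function of a factor under the Markov process obeys the same recursion.
-/

namespace MarkovModel

/-! ## Decomposition of the tree at its root -/

/-- The leaves of `T_{n+1}` as the leaves of the two copies of `T_n` below the root. -/
def halves (n : ℕ) : Fin 2 × Fin (2 ^ n) ≃ Fin (2 ^ (n + 1)) :=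
  finProdFinEquiv.trans (finCongr (by rw [pow_succ, mul_comm]))

/-- The permutation `(u, v) σ ^ s` of the leaves of `T_{n+1}`, where `σ` exchanges the two halves
and `u` and `v` act on the left and on the right half. -/
def node {n : ℕ} (u v : LeafPerm n) (s : Fin 2) : LeafPerm (n + 1) :=
  (halves n).permCongr <|
    Equiv.prodShear (Equiv.addRight s) fun b => if b + s = 0 then u else v

theorem fin_two_eq_zero_or_one (s : Fin 2) : s = 0 ∨ s = 1 := by decide +revert

theorem fin_two_add_self (s : Fin 2) : s + s = 0 := by decide +revert

section node

variable {n : ℕ} (u v u' v' : LeafPerm n) (s : Fin 2) (b b' : Fin 2) (i i' : Fin (2 ^ n))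

theorem halves_val : (halves n (b, i) : ℕ) = i + 2 ^ n * b := rfl

theorem node_apply :
    node u v s (halves n (b, i)) = halves n (b + s, (if b + s = 0 then u else v) i) := by
  simp [node, Equiv.permCongr_apply, Equiv.prodShear]

variable {u v u' v'} in
theorem leafPerm_ext {g g' : LeafPerm (n + 1)}
    (hg : ∀ b i, g (halves n (b, i)) = g' (halves n (b, i))) : g = g' :=
  Equiv.ext <| (halves n).surjective.forall.2 fun p => hg p.1 p.2

theorem node_zero_apply_zero : node u v 0 (halves n (0, i)) = halves n (0, u i) := by
  simp [node_apply]

theorem node_zero_apply_one : node u v 0 (halves n (1, i)) = halves n (1, v i) := by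
  simp [node_apply]

theorem node_one_apply_zero : node u v 1 (halves n (0, i)) = halves n (1, v i) := by
  simp [node_apply]

theorem node_one_apply_one : node u v 1 (halves n (1, i)) = halves n (0, u i) := by
  simp [node_apply]

theorem node_zero_mul : node u v 0 * node u' v' s = node (u * u') (v * v') s := by
  refine leafPerm_ext fun b i => ?_
  by_cases h : b + s = 0 <;> simp [node_apply, h]

theorem node_one_mul : node u v 1 * node u' v' s = node (u * v') (v * u') (1 + s) := by
  refine leafPerm_ext fun b i => ?_
  have h : b + (1 + s) = b + s + 1 := by rw [add_comm 1 s, add_assoc]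
  simp only [node_apply, h, Equiv.Perm.mul_apply]
  generalize b + s = c
  revert c
  simp [Fin.forall_fin_two]

theorem node_one_one_zero : node (1 : LeafPerm n) 1 0 = 1 :=
  leafPerm_ext fun b i => by simp [node_apply]

theorem node_zero_inv : (node u v 0)⁻¹ = node u⁻¹ v⁻¹ 0 := by
  rw [inv_eq_iff_mul_eq_one, node_zero_mul, mul_inv_cancel, mul_inv_cancel, node_one_one_zero]

theorem node_one_inv : (node u v 1)⁻¹ = node v⁻¹ u⁻¹ 1 := by
  rw [inv_eq_iff_mul_eq_one, node_one_mul, mul_inv_cancel, mul_inv_cancel, fin_two_add_self,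
    node_one_one_zero]

variable {u v u' v' s} in
theorem node_inj {s' : Fin 2} : node u v s = node u' v' s' ↔ u = u' ∧ v = v' ∧ s = s' := by
  refine ⟨fun h => ?_, fun ⟨hu, hv, hs⟩ => by rw [hu, hv, hs]⟩
  have hp (b i) : (b + s, (if b + s = 0 then u else v) i) =
      (b + s', (if b + s' = 0 then u' else v') i) :=
    (halves n).injective <| by rw [← node_apply, ← node_apply, h]
  obtain rfl : s = s' := by simpa using congrArg Prod.fst (hp 0 0)
  exact ⟨Equiv.ext fun i => by simpa [fin_two_add_self] using hp s i,
    Equiv.ext fun i => by simpa [fin_two_add_self, add_assoc] using hp (1 + s) i, rfl⟩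

theorem halves_div_of_lt {j : ℕ} (hj : n < j) : (halves n (b, i) : ℕ) / 2 ^ j = 0 :=
  Nat.div_eq_of_lt <| (halves n (b, i)).2.trans_le <| Nat.pow_le_pow_right two_pos hj

theorem halves_div_of_le {j : ℕ} (hj : j ≤ n) :
    (halves n (b, i) : ℕ) / 2 ^ j = i / 2 ^ j + 2 ^ (n - j) * b := by
  rw [halves_val, ← Nat.add_mul_div_left _ _ (by positivity), ← mul_assoc, ← pow_add,
    Nat.add_sub_cancel' hj]

theorem halves_div_two_pow : (halves n (b, i) : ℕ) / 2 ^ n = b := by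
  simp [halves_div_of_le b i le_rfl]

theorem halves_div_eq_iff {j : ℕ} :
    (halves n (b, i) : ℕ) / 2 ^ j = (halves n (b', i') : ℕ) / 2 ^ j ↔
      n < j ∨ b = b' ∧ (i : ℕ) / 2 ^ j = (i' : ℕ) / 2 ^ j := by
  rcases lt_or_ge n j with hj | hj
  · simp [halves_div_of_lt, hj]
  simp only [hj.not_gt, false_or]
  refine ⟨fun h => ?_, fun ⟨hb, hi⟩ => by simp only [halves_div_of_le _ _ hj, hb, hi]⟩
  have hdiv (p : ℕ) : p / 2 ^ j / 2 ^ (n - j) = p / 2 ^ n := by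
    rw [Nat.div_div_eq_div_mul, ← pow_add, Nat.add_sub_cancel' hj]
  obtain rfl : b = b' := Fin.ext <| by
    rw [← halves_div_two_pow b i, ← halves_div_two_pow b' i', ← hdiv, ← hdiv, h]
  simpa only [halves_div_of_le _ _ hj, add_left_inj, true_and] using h

variable {u v} in
theorem node_mem_treeAut (hu : u ∈ treeAut n) (hv : v ∈ treeAut n) :
    node u v s ∈ treeAut (n + 1) := by
  intro j i i'
  obtain ⟨⟨b, k⟩, rfl⟩ := (halves n).surjective i
  obtain ⟨⟨b', k'⟩, rfl⟩ := (halves n).surjective i'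
  rw [node_apply, node_apply, halves_div_eq_iff, halves_div_eq_iff, add_left_inj]
  refine or_congr Iff.rfl (and_congr_right ?_)
  rintro rfl
  split_ifs
  exacts [hu j k k', hv j k k']

end node

/-! ## The elements `x_k` at the root -/

theorem a_succ_of_le {n k : ℕ} (hk : k ≤ n) : a (n + 1) k = node (a n k) 1 0 := by
  refine leafPerm_ext fun b i => Fin.ext ?_
  rcases k.eq_zero_or_pos with rfl | hk0
  · simp [a, node_one_one_zero]
  have hpow : 2 * 2 ^ (k - 1) = 2 ^ k := by rw [← pow_succ', Nat.sub_add_cancel hk0]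
  have hle : 2 ^ k ≤ 2 ^ n := Nat.pow_le_pow_right two_pos hk
  have hk' : 1 ≤ k ∧ k ≤ n + 1 := ⟨hk0, by omega⟩
  revert b
  simp only [Fin.forall_fin_two, node_zero_apply_zero, node_zero_apply_one, a, dif_pos hk',
    dif_pos (⟨hk0, hk⟩ : 1 ≤ k ∧ k ≤ n), Equiv.coe_fn_mk, halves_val, aFun, hpow,
    Equiv.Perm.one_apply]
  constructor
  · simp
  · grind

theorem a_succ_self (n : ℕ) : a (n + 1) (n + 1) = node 1 1 1 := by
  refine leafPerm_ext fun b i => Fin.ext ?_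
  have hi := i.2
  revert b
  simp only [Fin.forall_fin_two, node_one_apply_zero, node_one_apply_one]
  constructor <;> simp [a, halves_val, aFun]
  omega

theorem x_succ (n k : ℕ) : x n (k + 1) = x n k * a n (k + 1) := by
  simp [x, List.range_succ]

theorem x_succ_of_le {n k : ℕ} (hk : k ≤ n) : x (n + 1) k = node (x n k) 1 0 := by
  induction k with
  | zero => exact node_one_one_zero.symm
  | succ k ih => rw [x_succ, x_succ, ih (by omega), a_succ_of_le hk, node_zero_mul, mul_one]

theorem x_succ_self (n : ℕ) : x (n + 1) (n + 1) = node (x n n) 1 1 := by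
  rw [x_succ, x_succ_of_le le_rfl, a_succ_self, node_zero_mul, mul_one, mul_one]

/-- The element of `W_n` that acts on the left half of the leaves of `T_{n+1}` as `m_{n+1}`. -/
def mLeft : (n : ℕ) → LeafPerm n
  | 0 => 1
  | n + 1 => node (x n n * mLeft n) 1 1

theorem x_mul_mLeft_succ (n : ℕ) :
    x (n + 1) (n + 1) * mLeft (n + 1) = node (x n n) (x n n * mLeft n) 0 := by
  rw [x_succ_self, mLeft, node_one_mul, mul_one, one_mul, fin_two_add_self]

/-! ## The element `m_n` at the root -/

section elementM

open Letter

section lift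

variable {n : ℕ}

/-- `g'` permutes the children of the leaves as `g` permutes the leaves, exchanging the left and
right children of `g i` if `P (g i)`. -/
def IsLift (g : LeafPerm n) (P : ℕ → Prop) [DecidablePred P] (g' : LeafPerm (n + 1)) : Prop :=
  ∀ i, g' (leftChild i) = (if P (g i) then rightChild (g i) else leftChild (g i)) ∧
    g' (rightChild i) = if P (g i) then leftChild (g i) else rightChild (g i)

theorem leftChild_halves (b : Fin 2) (i : Fin (2 ^ n)) :
    leftChild (halves n (b, i)) = halves (n + 1) (b, leftChild i) := by
  ext
  simp only [leftChild, halves_val, pow_succ]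
  ring

theorem rightChild_halves (b : Fin 2) (i : Fin (2 ^ n)) :
    rightChild (halves n (b, i)) = halves (n + 1) (b, rightChild i) := by
  ext
  simp only [rightChild, halves_val, pow_succ]
  ring

theorem leftChild_injective : Function.Injective (leftChild (n := n)) := fun i j h => by
  simp only [leftChild, Fin.mk.injEq] at h
  omega

theorem rightChild_injective : Function.Injective (rightChild (n := n)) := fun i j h => by
  simp only [rightChild, Fin.mk.injEq] at h
  omega

theorem leftChild_ne_rightChild (i j : Fin (2 ^ n)) : leftChild i ≠ rightChild j := fun h => by
  simp only [leftChild, rightChild, Fin.mk.injEq] at h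
  omega

theorem eq_leftChild_or_rightChild (i : Fin (2 ^ (n + 1))) :
    ∃ j, i = leftChild j ∨ i = rightChild j := by
  have hi := i.2.trans_eq (pow_succ 2 n)
  refine ⟨⟨i / 2, by omega⟩, ?_⟩
  simp only [leftChild, rightChild, Fin.ext_iff]
  omega

theorem IsLift.one : IsLift (1 : LeafPerm n) (fun _ => False) 1 := fun i => by simp

theorem IsLift.node {u v : LeafPerm n} {P Q R : ℕ → Prop} [DecidablePred P] [DecidablePred Q]
    [DecidablePred R] {u' v' : LeafPerm (n + 1)} (hu : IsLift u P u') (hv : IsLift v Q v')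
    (s : Fin 2) (hP : ∀ i < 2 ^ n, R i ↔ P i) (hQ : ∀ i < 2 ^ n, R (i + 2 ^ n) ↔ Q i) :
    IsLift (MarkovModel.node u v s) R (MarkovModel.node u' v' s) := by
  refine (halves n).surjective.forall.2 fun ⟨b, i⟩ => ?_
  simp only [leftChild_halves, rightChild_halves, node_apply, halves_val]
  generalize b + s = c
  revert c
  simp [Fin.forall_fin_two, hP _ (u i).2, hQ _ (v i).2,
    hu i, hv i, apply_ite (halves _), apply_ite (Prod.mk _)]

theorem IsLift.map_cycle {g : LeafPerm n} {P : ℕ → Prop} [DecidablePred P] {g' : LeafPerm (n + 1)}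
    (hg : IsLift g P g') {p : Fin (2 ^ n)} {l : List (Fin (2 ^ n))}
    (hrot : (p :: l).map g = l ++ [p]) (hl : ∀ i ∈ l, ¬ P i) :
    ((p :: l).map leftChild).map g' =
        l.map leftChild ++ [if P p then rightChild p else leftChild p] ∧
      ((p :: l).map rightChild).map g' =
        l.map rightChild ++ [if P p then leftChild p else rightChild p] := by
  have hmap (e f : Fin (2 ^ n) → Fin (2 ^ (n + 1)))
      (he : ∀ i, g' (e i) = if P (g i) then f (g i) else e (g i)) :
      ((p :: l).map e).map g' = l.map e ++ [if P p then f p else e p] := by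
    calc ((p :: l).map e).map g' = ((p :: l).map g).map
          fun i : Fin (2 ^ n) => if P i then f i else e i := by
          simp only [List.map_map, Function.comp_def, he]
      _ = l.map e ++ [if P p then f p else e p] := by
          rw [hrot, List.map_append, List.map_singleton,
            List.map_congr_left fun i hi => if_neg (hl i hi)]
  exact ⟨hmap _ _ fun i => (hg i).1, hmap _ _ fun i => (hg i).2⟩

end lift

section leafType

/-- The type of the cycle of `m_{k+2}` whose smallest entry is the leaf `i`; it is `ss` for a leaf
that is not the smallest of its cycle. -/
def leafType : ℕ → ℕ → Typ
  | 0, i => if i = 0 then [s, n] else [s, s]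
  | k + 1, i => (restricted (leafType k (i / 2))).getD (i % 2) [s, s]

theorem leafType_cases (k i : ℕ) :
    leafType k i = [n, n] ∨ leafType k i = [s, n] ∨ leafType k i = [s, s] := by
  induction k generalizing i with
  | zero => by_cases hi : i = 0 <;> simp [leafType, hi]
  | succ k ih =>
    rcases ih (i / 2) with h | h | h <;> rcases Nat.mod_two_eq_zero_or_one i with hi | hi <;>
      simp [leafType, h, hi, restricted]

theorem leafType_leftChild {N : ℕ} (k : ℕ) (i : Fin (2 ^ N)) :
    leafType (k + 1) (leftChild i) = (restricted (leafType k i)).getD 0 [s, s] := by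
  simp [leafType, leftChild]

theorem leafType_rightChild {N : ℕ} (k : ℕ) (i : Fin (2 ^ N)) :
    leafType (k + 1) (rightChild i) = (restricted (leafType k i)).getD 1 [s, s] := by
  simp only [leafType, rightChild, Nat.mul_add_mod, Nat.mul_add_div two_pos, Nat.one_mod,
    Nat.reduceDiv, add_zero]

theorem leafType_of_le {k i : ℕ} (hi : 2 ^ k ≤ i) : leafType k i = [s, s] := by
  induction k generalizing i with
  | zero => rw [leafType, if_neg (by omega)]
  | succ k ih =>
    rw [pow_succ] at hi
    rcases Nat.mod_two_eq_zero_or_one i with h | h <;>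
      simp [leafType, ih (show 2 ^ k ≤ i / 2 by omega), restricted, h]

theorem leafType_succ_of_lt {k i : ℕ} (hi : i < 2 ^ k) :
    leafType (k + 1) i = if i = 0 then [n, n] else [s, s] := by
  induction k generalizing i with
  | zero =>
    obtain rfl : i = 0 := by omega
    rfl
  | succ k ih =>
    rw [pow_succ] at hi
    rw [leafType, ih (show i / 2 < 2 ^ k by omega)]
    rcases i with _ | _ | i
    · rfl
    · rfl
    · rw [if_neg (by omega), if_neg (by omega)]
      rcases Nat.mod_two_eq_zero_or_one (i + 1 + 1) with h | h <;> simp [restricted, h]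

theorem leafType_succ_add (k i : ℕ) : leafType (k + 1) (i + 2 ^ k) = leafType k i := by
  induction k generalizing i with
  | zero =>
    rcases i with _ | i
    · rfl
    · rw [leafType_of_le (by simp), leafType, if_neg (by omega)]
  | succ k ih =>
    rw [leafType, pow_succ, Nat.add_mul_mod_self_right, Nat.add_mul_div_right _ _ two_pos, ih]
    rfl

theorem isLift_x (n : ℕ) : IsLift (x n n) (· = 0) (x (n + 1) (n + 1)) := by
  induction n with
  | zero => unfold IsLift; decide
  | succ n ih =>
    rw [x_succ_self, x_succ_self (n + 1)]
    exact ih.node IsLift.one 1 (fun i _ => Iff.rfl) (by simp)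

theorem isLift_x_mul_mLeft (k : ℕ) :
    IsLift (x k k * mLeft k) (leafType k · = [n, n]) (x (k + 1) (k + 1) * mLeft (k + 1)) := by
  induction k with
  | zero => unfold IsLift; decide
  | succ k ih =>
    rw [x_mul_mLeft_succ, x_mul_mLeft_succ]
    refine (isLift_x k).node ih 0 (fun i hi => ?_) fun i _ => by rw [leafType_succ_add]
    rw [leafType_succ_of_lt hi]
    split_ifs with h <;> simp [h]

theorem isLift_node_mLeft (k : ℕ) :
    IsLift (node (mLeft (k + 1)) 1 0) (leafType k · = [n, n]) (node (mLeft (k + 2)) 1 0) := by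
  have hright {j : ℕ} (hj : k ≤ j) (i : ℕ) : leafType k (i + 2 ^ j) = [n, n] ↔ False := by
    rw [leafType_of_le ((Nat.pow_le_pow_right two_pos hj).trans (Nat.le_add_left _ _))]
    decide
  have hleft : IsLift (mLeft (k + 1)) (leafType k · = [n, n]) (mLeft (k + 2)) :=
    (isLift_x_mul_mLeft k).node IsLift.one 1 (fun _ _ => Iff.rfl) fun i _ => hright le_rfl i
  exact hleft.node IsLift.one 0 (fun _ _ => Iff.rfl) fun i _ => hright k.le_succ i

end leafType

section cycles

variable {α : Type*} [DecidableEq α]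

theorem formPerm_apply_of_map_eq_rotate {g : Equiv.Perm α} {c : List α} (hc : c.Nodup)
    (hg : c.map g = c.rotate 1) {i : α} (hi : i ∈ c) : c.formPerm i = g i := by
  obtain ⟨k, hk, rfl⟩ := List.getElem_of_mem hi
  rw [List.formPerm_apply_getElem _ hc, ← List.getElem_rotate _ _ _ (by simpa using hk),
    ← List.getElem_map g (h := by simpa using hk)]
  simp only [hg]

theorem prod_formPerm_apply_of_notMem {L : List (List α)} {i : α} (hi : i ∉ L.flatten) :
    (L.map List.formPerm).prod i = i := by
  induction L with
  | nil => simp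
  | cons d L ih =>
    simp only [List.flatten_cons, List.mem_append, not_or] at hi
    rw [List.map_cons, List.prod_cons, Equiv.Perm.mul_apply, ih hi.2,
      List.formPerm_apply_of_notMem hi.1]

theorem prod_formPerm_apply {L : List (List α)} (hL : L.flatten.Nodup) {c : List α} (hc : c ∈ L)
    {i : α} (hi : i ∈ c) : (L.map List.formPerm).prod i = c.formPerm i := by
  induction L with
  | nil => simp at hc
  | cons d L ih =>
    rw [List.flatten_cons, List.nodup_append] at hL
    obtain ⟨-, hL, hd⟩ := hL
    rw [List.map_cons, List.prod_cons, Equiv.Perm.mul_apply]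
    rcases List.mem_cons.1 hc with rfl | hc
    · rw [prod_formPerm_apply_of_notMem fun h => hd i hi i h rfl]
    · rw [ih hL hc]
      exact List.formPerm_apply_of_notMem fun h =>
        hd _ h _ (List.mem_flatten_of_mem hc (List.formPerm_apply_mem_of_mem hi)) rfl

end cycles

/-- A typed cycle of `m_{k+2}`: it is mapped by `g` to its rotation, has the type given by its first
entry, and no other entry has a type other than `ss`. -/
def IsTypedCycle {k : ℕ} (g : LeafPerm (k + 2)) (c : TypedCycle (k + 2)) : Prop :=
  ∃ (p : Fin (2 ^ (k + 2))) (l : List (Fin (2 ^ (k + 2)))), c = (p :: l, leafType k p) ∧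
    (p :: l).map g = l ++ [p] ∧ ∀ i ∈ l, leafType k i = [s, s]

theorem IsTypedCycle.of_mem_markovMapCycle {k : ℕ} {g : LeafPerm (k + 2)} {g' : LeafPerm (k + 3)}
    {c : TypedCycle (k + 2)} (hc : IsTypedCycle g c) (hg : IsLift g (leafType k · = [n, n]) g') :
    ∀ d ∈ markovMapCycle c, IsTypedCycle (k := k + 1) g' d := by
  obtain ⟨p, l, rfl, hrot, hl⟩ := hc
  have hleft : ∀ i ∈ l, leafType (k + 1) (leftChild i) = [s, s] := fun i hi => by
    rw [leafType_leftChild, hl i hi]; rfl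
  have hright : ∀ i ∈ l, leafType (k + 1) (rightChild i) = [s, s] := fun i hi => by
    rw [leafType_rightChild, hl i hi]; rfl
  obtain ⟨hrotl, hrotr⟩ := hg.map_cycle hrot fun i hi => by rw [hl i hi]; decide
  have hpl := leafType_leftChild k p
  have hpr := leafType_rightChild k p
  rcases leafType_cases k p with hp | hp | hp
  · rw [hp] at hpl hpr
    rw [if_pos hp] at hrotl hrotr
    simp only [markovMapCycle, hp, restricted, List.forall_mem_singleton]
    refine ⟨leftChild p, l.map leftChild ++ (p :: l).map rightChild, ?_, ?_, ?_⟩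
    · rw [hpl]; rfl
    · rw [← List.cons_append, ← List.map_cons, List.map_append, hrotl, hrotr]
      simp
    · simp only [List.forall_mem_append, List.forall_mem_map, List.forall_mem_cons]
      exact ⟨hleft, hpr, hright⟩
  all_goals
    have hne : leafType k p ≠ [n, n] := by rw [hp]; decide
    rw [hp] at hpl hpr
    rw [if_neg hne] at hrotl hrotr
    simp only [markovMapCycle, hp, restricted, List.forall_mem_cons]
    exact ⟨⟨_, _, by rw [hpl]; rfl, hrotl, List.forall_mem_map.2 hleft⟩,
      ⟨_, _, by rw [hpr]; rfl, hrotr, List.forall_mem_map.2 hright⟩, by simp⟩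

theorem IsTypedCycle.flatMap_markovMapCycle {k : ℕ} {g : LeafPerm (k + 2)}
    {c : TypedCycle (k + 2)} (hc : IsTypedCycle g c) :
    (markovMapCycle c).flatMap Prod.fst =
      c.1.map leftChild ++ c.1.map rightChild := by
  obtain ⟨p, l, rfl, -, -⟩ := hc
  rcases leafType_cases k p with hp | hp | hp <;> simp [markovMapCycle, hp, restricted]

theorem isTypedCycle_of_mem_mCycles {k : ℕ} :
    ∀ c ∈ mCycles k, IsTypedCycle (node (mLeft (k + 1)) 1 0) c := by
  induction k with
  | zero =>
    simp only [mCycles, List.forall_mem_cons]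
    exact ⟨⟨0, [1], rfl, by decide, by decide⟩, ⟨2, [], rfl, by decide, by simp⟩,
      ⟨3, [], rfl, by decide, by simp⟩, by simp⟩
  | succ k ih =>
    simp only [mCycles, List.mem_flatMap]
    rintro d ⟨c, hc, hd⟩
    exact (ih c hc).of_mem_markovMapCycle (isLift_node_mLeft k) d hd

theorem mCycles_succ_perm (k : ℕ) :
    ((mCycles (k + 1)).flatMap Prod.fst).Perm
      (((mCycles k).flatMap Prod.fst).map leftChild ++
        ((mCycles k).flatMap Prod.fst).map rightChild) := by
  rw [mCycles, List.flatMap_assoc, List.map_flatMap, List.map_flatMap,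
    List.flatMap_congr fun c hc => (isTypedCycle_of_mem_mCycles c hc).flatMap_markovMapCycle]
  exact (List.flatMap_append_perm _ _ _).symm

theorem nodup_mCycles (k : ℕ) : ((mCycles k).flatMap Prod.fst).Nodup := by
  induction k with
  | zero => decide
  | succ k ih =>
    rw [(mCycles_succ_perm k).nodup_iff, List.nodup_append]
    refine ⟨ih.map leftChild_injective, ih.map rightChild_injective, ?_⟩
    simp only [List.forall_mem_map]
    exact fun i _ j _ => leftChild_ne_rightChild i j

theorem mem_mCycles (k : ℕ) : ∀ i, i ∈ (mCycles k).flatMap Prod.fst := by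
  induction k with
  | zero => decide
  | succ k ih =>
    intro i
    rw [(mCycles_succ_perm k).mem_iff, List.mem_append, List.mem_map, List.mem_map]
    obtain ⟨j, rfl | rfl⟩ := eq_leftChild_or_rightChild i
    exacts [Or.inl ⟨j, ih j, rfl⟩, Or.inr ⟨j, ih j, rfl⟩]

theorem m_succ (n : ℕ) : m (n + 1) = node (mLeft n) 1 0 := by
  rcases n with _ | k
  · exact node_one_one_zero.symm
  refine Equiv.ext fun i => ?_
  obtain ⟨c, hc, hi⟩ := List.mem_flatMap.1 (mem_mCycles k i)
  have hcL : c.1 ∈ (mCycles k).map Prod.fst := List.mem_map_of_mem hc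
  have hnodup : ((mCycles k).map Prod.fst).flatten.Nodup := by
    simpa only [List.flatMap_def] using nodup_mCycles k
  have hprod : m (k + 2) = (((mCycles k).map Prod.fst).map List.formPerm).prod := by
    rw [m, List.map_map]; rfl
  rw [hprod, prod_formPerm_apply hnodup hcL hi]
  refine formPerm_apply_of_map_eq_rotate ((List.nodup_flatten.1 hnodup).1 _ hcL) ?_ hi
  obtain ⟨p, l, rfl, hrot, -⟩ := isTypedCycle_of_mem_mCycles c hc
  simpa using hrot

end elementM

/-! ## Permutations of a given type -/

/-- `(u, v) ↦ node u v 0` as a homomorphism. -/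
def nodeHom (n : ℕ) : LeafPerm n × LeafPerm n →* LeafPerm (n + 1) where
  toFun p := node p.1 p.2 0
  map_one' := node_one_one_zero
  map_mul' p q := (node_zero_mul p.1 p.2 q.1 q.2 0).symm

theorem node_zero_zpow {n : ℕ} (u v : LeafPerm n) (z : ℤ) :
    node u v 0 ^ z = node (u ^ z) (v ^ z) 0 :=
  (map_zpow (nodeHom n) (u, v) z).symm

/-- The elements of `W_k` of type `T`, where `0` and `1` stand for the letters `s` and `n`: they are
exactly those that exchange the two halves if the first letter of `T` is `n`, and the types of their
sections multiply to the type with the two letters exchanged, as `h_a` prescribes. -/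
def typeFiber : (k : ℕ) → Fin 2 × Fin 2 → Set (LeafPerm k)
  | 0, _ => {1}
  | k + 1, T => {g | ∃ u v P Q, u ∈ typeFiber k P ∧ v ∈ typeFiber k Q ∧ P + Q = T.swap ∧
      g = node u v T.1}

section typeFiber

variable {n : ℕ} {T T' : Fin 2 × Fin 2}

theorem type_add_self (T : Fin 2 × Fin 2) : T + T = 0 :=
  Prod.ext (fin_two_add_self T.1) (fin_two_add_self T.2)

theorem node_mem_typeFiber {u v : LeafPerm n} {P Q : Fin 2 × Fin 2} (hu : u ∈ typeFiber n P)
    (hv : v ∈ typeFiber n Q) (hT : P + Q = T.swap) : node u v T.1 ∈ typeFiber (n + 1) T :=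
  ⟨u, v, P, Q, hu, hv, hT, rfl⟩

theorem one_mem_typeFiber (n : ℕ) : 1 ∈ typeFiber n 0 := by
  induction n with
  | zero => rfl
  | succ n ih =>
    rw [← node_one_one_zero]
    exact node_mem_typeFiber ih ih rfl

theorem mul_mem_typeFiber {g h : LeafPerm n} (hg : g ∈ typeFiber n T) (hh : h ∈ typeFiber n T') :
    g * h ∈ typeFiber n (T + T') := by
  induction n generalizing T T' with
  | zero =>
    obtain rfl : g = 1 := hg
    obtain rfl : h = 1 := hh
    rfl
  | succ n ih =>
    obtain ⟨u, v, P, Q, hu, hv, hT, rfl⟩ := hg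
    obtain ⟨u', v', P', Q', hu', hv', hT', rfl⟩ := hh
    obtain ⟨s, t⟩ := T
    obtain rfl | rfl := fin_two_eq_zero_or_one s
    · rw [node_zero_mul, ← zero_add T'.1]
      refine node_mem_typeFiber (T := (0, t) + T') (ih hu hu') (ih hv hv') ?_
      rw [Prod.swap_add, ← hT, ← hT', add_add_add_comm]
    · rw [node_one_mul]
      refine node_mem_typeFiber (T := (1, t) + T') (ih hu hv') (ih hv hu') ?_
      rw [Prod.swap_add, ← hT, ← hT', add_add_add_comm, add_comm Q']

theorem inv_mem_typeFiber {g : LeafPerm n} (hg : g ∈ typeFiber n T) : g⁻¹ ∈ typeFiber n T := by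
  induction n generalizing T with
  | zero =>
    obtain rfl : g = 1 := hg
    rfl
  | succ n ih =>
    obtain ⟨u, v, P, Q, hu, hv, hT, rfl⟩ := hg
    obtain ⟨s, t⟩ := T
    obtain rfl | rfl := fin_two_eq_zero_or_one s
    · rw [node_zero_inv]
      exact node_mem_typeFiber (T := (0, t)) (ih hu) (ih hv) hT
    · rw [node_one_inv]
      exact node_mem_typeFiber (T := (1, t)) (ih hv) (ih hu) (by rw [add_comm, hT])

theorem typeFiber_subset_treeAut : typeFiber n T ⊆ treeAut n := by
  induction n generalizing T with
  | zero =>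
    rintro _ rfl
    exact one_mem _
  | succ n ih =>
    rintro _ ⟨u, v, P, Q, hu, hv, -, rfl⟩
    exact node_mem_treeAut _ (ih hu) (ih hv)

theorem fst_eq_of_mem_typeFiber {g : LeafPerm (n + 1)} (hg : g ∈ typeFiber (n + 1) T)
    (hg' : g ∈ typeFiber (n + 1) T') : T.1 = T'.1 := by
  obtain ⟨u, v, P, Q, -, -, -, rfl⟩ := hg
  obtain ⟨u', v', P', Q', -, -, -, h⟩ := hg'
  exact (node_inj.1 h).2.2

theorem snd_eq_of_mem_typeFiber {g : LeafPerm (n + 2)} (hg : g ∈ typeFiber (n + 2) T)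
    (hg' : g ∈ typeFiber (n + 2) T') : T.2 = T'.2 := by
  obtain ⟨u, v, P, Q, hu, hv, hT, rfl⟩ := hg
  obtain ⟨u', v', P', Q', hu', hv', hT', h⟩ := hg'
  obtain ⟨rfl, rfl, -⟩ := node_inj.1 h
  rw [← Prod.fst_swap, ← Prod.fst_swap, ← hT, ← hT', Prod.fst_add, Prod.fst_add,
    fst_eq_of_mem_typeFiber hu hu', fst_eq_of_mem_typeFiber hv hv']

theorem x_mem_typeFiber (n : ℕ) : x n n ∈ typeFiber n (1, 1) := by
  induction n with
  | zero => rfl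
  | succ n ih =>
    rw [x_succ_self]
    exact node_mem_typeFiber (T := (1, 1)) ih (one_mem_typeFiber n) rfl

theorem mLeft_mem_typeFiber (n : ℕ) : mLeft n ∈ typeFiber n (1, 0) := by
  induction n with
  | zero => rfl
  | succ n ih =>
    exact node_mem_typeFiber (T := (1, 0)) (mul_mem_typeFiber (x_mem_typeFiber n) ih)
      (one_mem_typeFiber n) rfl

theorem m_mem_typeFiber (n : ℕ) : m n ∈ typeFiber n (0, 1) := by
  cases n with
  | zero => rfl
  | succ n =>
    rw [m_succ]
    exact node_mem_typeFiber (T := (0, 1)) (mLeft_mem_typeFiber n) (one_mem_typeFiber n) rfl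

theorem x_sq_succ_of_le {i : ℕ} (hi : i ≤ n) : x (n + 1) i ^ 2 = node (x n i ^ 2) 1 0 := by
  rw [x_succ_of_le hi, sq, sq, node_zero_mul, one_mul]

theorem x_sq_succ_self (n : ℕ) : x (n + 1) (n + 1) ^ 2 = node (x n n) (x n n) 0 := by
  rw [x_succ_self, sq, node_one_mul, mul_one, one_mul, fin_two_add_self]

theorem x_sq_mem_typeFiber {i : ℕ} (hi : i ≤ n) : x n i ^ 2 ∈ typeFiber n 0 := by
  induction n with
  | zero =>
    obtain rfl := Nat.le_zero.1 hi
    rfl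
  | succ n ih =>
    obtain h | rfl := Nat.le_or_eq_of_le_succ hi
    · rw [x_sq_succ_of_le h]
      exact node_mem_typeFiber (T := 0) (ih h) (one_mem_typeFiber n) rfl
    · rw [sq]
      exact mul_mem_typeFiber (x_mem_typeFiber (n + 1)) (x_mem_typeFiber (n + 1))

end typeFiber

/-! ## Odometers -/

section odometer

variable {n : ℕ} {u v : LeafPerm n}

theorem node_one_zpow_two_mul (u v : LeafPerm n) (z : ℤ) :
    node u v 1 ^ (2 * z) = node ((u * v) ^ z) ((v * u) ^ z) 0 := by
  rw [zpow_mul, zpow_ofNat, sq, node_one_mul, fin_two_add_self, node_zero_zpow]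

theorem sameCycle_node_one (huv : ∀ i j, (u * v).SameCycle i j) (i j : Fin (2 ^ (n + 1))) :
    (node u v 1).SameCycle i j := by
  have hleft (k l) : (node u v 1).SameCycle (halves n (0, k)) (halves n (0, l)) := by
    obtain ⟨z, hz⟩ := huv k l
    exact ⟨2 * z, by rw [node_one_zpow_two_mul, node_zero_apply_zero, hz]⟩
  have hreach (i) : ∃ k, (node u v 1).SameCycle i (halves n (0, k)) := by
    obtain ⟨⟨b, k⟩, rfl⟩ := (halves n).surjective i
    obtain rfl | rfl := fin_two_eq_zero_or_one b
    · exact ⟨k, Equiv.Perm.SameCycle.refl _ _⟩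
    · exact ⟨u k, 1, by rw [zpow_one, node_one_apply_one]⟩
  obtain ⟨k, hk⟩ := hreach i
  obtain ⟨l, hl⟩ := hreach j
  exact hk.trans ((hleft k l).trans hl.symm)

theorem sameCycle_of_node_one (h : ∀ i j, (node u v 1).SameCycle i j) (i j : Fin (2 ^ n)) :
    (u * v).SameCycle i j := by
  obtain ⟨z, hz⟩ := h (halves n (0, i)) (halves n (0, j))
  obtain ⟨y, rfl | rfl⟩ := Int.even_or_odd' z
  · rw [node_one_zpow_two_mul, node_zero_apply_zero] at hz
    exact ⟨y, by simpa using hz⟩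
  · rw [add_comm (2 * y) 1, zpow_one_add, node_one_zpow_two_mul, Equiv.Perm.mul_apply,
      node_zero_apply_zero, node_one_apply_zero] at hz
    simp at hz

theorem not_sameCycle_node_zero (i j : Fin (2 ^ n)) :
    ¬ (node u v 0).SameCycle (halves n (0, i)) (halves n (1, j)) := by
  rintro ⟨z, hz⟩
  rw [node_zero_zpow, node_zero_apply_zero] at hz
  simp at hz

theorem sameCycle_of_mem_typeFiber {w : LeafPerm n} (hw : w ∈ typeFiber n (1, 1))
    (i j : Fin (2 ^ n)) : w.SameCycle i j := by
  induction n with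
  | zero =>
    obtain rfl : i = j := Subsingleton.elim (α := Fin 1) i j
    exact Equiv.Perm.SameCycle.refl _ _
  | succ n ih =>
    obtain ⟨u, v, P, Q, hu, hv, hT, rfl⟩ := hw
    have huv := mul_mem_typeFiber hu hv
    rw [hT] at huv
    exact sameCycle_node_one (ih huv) i j

variable {T : Fin 2 × Fin 2}

theorem fst_eq_one_of_sameCycle {w : LeafPerm (n + 1)} (hw : w ∈ typeFiber (n + 1) T)
    (h : ∀ i j, w.SameCycle i j) : T.1 = 1 := by
  obtain ⟨u, v, P, Q, -, -, -, rfl⟩ := hw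
  refine (fin_two_eq_zero_or_one T.1).resolve_left fun hT => ?_
  rw [hT] at h
  exact not_sameCycle_node_zero 0 0 (h _ _)

theorem snd_eq_one_of_sameCycle {w : LeafPerm (n + 2)} (hw : w ∈ typeFiber (n + 2) T)
    (h : ∀ i j, w.SameCycle i j) : T.2 = 1 := by
  have hT1 := fst_eq_one_of_sameCycle hw h
  obtain ⟨u, v, P, Q, hu, hv, hT, rfl⟩ := hw
  rw [hT1] at h
  rw [← Prod.fst_swap, ← hT]
  exact fst_eq_one_of_sameCycle (mul_mem_typeFiber hu hv) (sameCycle_of_node_one h)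

end odometer

/-! ## The groups `M_n(2)` in terms of types -/

section groups

variable {n : ℕ}

/-- The elements of `W_n` that have a type. -/
def typedGroup (n : ℕ) : Subgroup (LeafPerm n) where
  carrier := {g | ∃ T, g ∈ typeFiber n T}
  one_mem' := ⟨0, one_mem_typeFiber n⟩
  mul_mem' := fun ⟨_, hg⟩ ⟨_, hh⟩ => ⟨_, mul_mem_typeFiber hg hh⟩
  inv_mem' := fun ⟨_, hg⟩ => ⟨_, inv_mem_typeFiber hg⟩

/-- The elements of `W_n` of type `ns` or `ss`. -/
def evenTypedGroup (n : ℕ) : Subgroup (LeafPerm n) where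
  carrier := {g | ∃ s, g ∈ typeFiber n (s, 0)}
  one_mem' := ⟨0, one_mem_typeFiber n⟩
  mul_mem' := fun ⟨_, hg⟩ ⟨_, hh⟩ => ⟨_, mul_mem_typeFiber hg hh⟩
  inv_mem' := fun ⟨_, hg⟩ => ⟨_, inv_mem_typeFiber hg⟩

theorem mem_evenTypedGroup {g : LeafPerm n} :
    g ∈ evenTypedGroup n ↔ ∃ s, g ∈ typeFiber n (s, 0) := Iff.rfl

theorem evenTypedGroup_le_treeAut (n : ℕ) : evenTypedGroup n ≤ treeAut n :=
  fun _ ⟨_, hg⟩ => typeFiber_subset_treeAut hg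

theorem conj_mem_evenTypedGroup {g h : LeafPerm n} (hg : g ∈ typedGroup n)
    (hh : h ∈ evenTypedGroup n) : g * h * g⁻¹ ∈ evenTypedGroup n := by
  obtain ⟨⟨s, t⟩, hg⟩ := hg
  obtain ⟨s', hh⟩ := hh
  have hghg := mul_mem_typeFiber (mul_mem_typeFiber hg hh) (inv_mem_typeFiber hg)
  rw [add_right_comm, type_add_self, zero_add] at hghg
  exact ⟨s', hghg⟩

theorem M_le_typedGroup (n : ℕ) : M n ≤ typedGroup n := by
  rw [M, Subgroup.closure_le]
  rintro g ((rfl | rfl) | ⟨i, hi, rfl⟩)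
  · exact ⟨_, x_mem_typeFiber n⟩
  · exact ⟨_, m_mem_typeFiber n⟩
  · exact ⟨_, x_sq_mem_typeFiber (by omega)⟩

theorem x_mem_M (n : ℕ) : x n n ∈ M n := Subgroup.subset_closure (Or.inl (Or.inl rfl))

theorem m_mem_H (n : ℕ) : m n ∈ H n := Subgroup.subset_closure (Or.inl rfl)

theorem x_sq_mem_H {i : ℕ} (hi : 2 ≤ i) (hin : i < n) : x n i ^ 2 ∈ H n := by
  obtain ⟨j, rfl⟩ := Nat.exists_eq_add_of_le' hi
  exact Subgroup.subset_closure (Or.inr ⟨j, hin, rfl⟩)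

theorem H_le_M (n : ℕ) : H n ≤ M n :=
  Subgroup.closure_mono
    (Set.union_subset_union_left _ (Set.singleton_subset_iff.2 (Set.mem_insert_of_mem _ rfl)))

theorem H_le_N (n : ℕ) : H n ≤ N n := fun h hh =>
  Subgroup.subset_closure ⟨1, one_mem _, h, hh, by simp⟩

theorem N_le_M (n : ℕ) : N n ≤ M n := by
  rw [N, Subgroup.closure_le]
  rintro _ ⟨g, hg, h, hh, rfl⟩
  exact mul_mem (mul_mem hg (H_le_M n hh)) (inv_mem hg)

theorem M_le_normalizer_N (n : ℕ) : M n ≤ Subgroup.normalizer (N n) := by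
  rw [N, Subgroup.le_normalizer_closure_iff]
  rintro g hg _ ⟨g', hg', h, hh, rfl⟩
  exact Subgroup.subset_closure ⟨g * g', mul_mem hg hg', h, hh, by group⟩

theorem conj_mem_N {g y : LeafPerm n} (hg : g ∈ M n) (hy : y ∈ N n) : g * y * g⁻¹ ∈ N n :=
  Subgroup.le_normalizer_iff.1 (M_le_normalizer_N n) g hg y hy

theorem M2_le_M (n : ℕ) : M2 n ≤ M n := by
  rw [M2, Subgroup.closure_le]
  rintro g ((rfl | rfl) | ⟨hg, -⟩)
  · exact pow_mem (x_mem_M n) 2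
  · exact mul_mem (x_mem_M n) (H_le_M n (m_mem_H n))
  · exact N_le_M n hg

theorem H_succ_le (n : ℕ) :
    H (n + 1) ≤ ((evenTypedGroup n).prod (evenTypedGroup n)).map (nodeHom n) := by
  rw [H, Subgroup.closure_le]
  rintro h (rfl | ⟨i, hi, rfl⟩)
  · exact ⟨(mLeft n, 1), ⟨⟨1, mLeft_mem_typeFiber n⟩, one_mem _⟩, (m_succ n).symm⟩
  · exact ⟨(x n (i + 2) ^ 2, 1), ⟨⟨0, x_sq_mem_typeFiber (by omega)⟩, one_mem _⟩,
      (x_sq_succ_of_le (by omega)).symm⟩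

theorem N_succ_le (n : ℕ) :
    N (n + 1) ≤ ((evenTypedGroup n).prod (evenTypedGroup n)).map (nodeHom n) := by
  rw [N, Subgroup.closure_le]
  rintro _ ⟨g, hg, h, hh, rfl⟩
  obtain ⟨⟨u, v⟩, ⟨hu, hv⟩, rfl⟩ := H_succ_le n hh
  obtain ⟨⟨s, t⟩, a, b, P, Q, ha, hb, -, rfl⟩ := M_le_typedGroup _ hg
  have ha : a ∈ typedGroup n := ⟨P, ha⟩
  have hb : b ∈ typedGroup n := ⟨Q, hb⟩
  obtain rfl | rfl := fin_two_eq_zero_or_one s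
  · refine ⟨(a * u * a⁻¹, b * v * b⁻¹),
      ⟨conj_mem_evenTypedGroup ha hu, conj_mem_evenTypedGroup hb hv⟩, ?_⟩
    simp only [nodeHom, MonoidHom.coe_mk, OneHom.coe_mk, node_zero_inv, node_zero_mul]
  · refine ⟨(a * v * a⁻¹, b * u * b⁻¹),
      ⟨conj_mem_evenTypedGroup ha hv, conj_mem_evenTypedGroup hb hu⟩, ?_⟩
    simp only [nodeHom, MonoidHom.coe_mk, OneHom.coe_mk, node_one_inv, node_one_mul, add_zero,
      fin_two_add_self]

theorem x_mul_m_mem_typeFiber (n : ℕ) : x n n * m n ∈ typeFiber n (1, 0) :=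
  mul_mem_typeFiber (x_mem_typeFiber n) (m_mem_typeFiber n)

/-- Since `x_n` has type `nn`, an element of `N_n` whose product with `x_n` is an odometer has
type `ss`. -/
theorem od_N_subset_typeFiber (n : ℕ) : od (N (n + 1)) ⊆ typeFiber (n + 1) 0 := by
  rintro g ⟨hg, -, hodo⟩
  obtain ⟨⟨u, v⟩, ⟨⟨p, hu⟩, ⟨q, hv⟩⟩, rfl⟩ := N_succ_le n hg
  change node u v 0 ∈ _
  cases n with
  | zero => exact node_mem_typeFiber (T := 0) (P := 0) (Q := 0) hu hv rfl
  | succ n =>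
    have huv : node u v 0 ∈ typeFiber (n + 2) (0, p + q) := node_mem_typeFiber hu hv rfl
    have hxuv := snd_eq_one_of_sameCycle (mul_mem_typeFiber (x_mem_typeFiber _) huv) hodo
    obtain hpq : p + q = 0 := add_eq_left.1 hxuv
    rwa [hpq] at huv

theorem M2_succ_le (n : ℕ) : M2 (n + 1) ≤ evenTypedGroup (n + 1) := by
  rw [M2, Subgroup.closure_le]
  rintro g ((rfl | rfl) | hg)
  · exact ⟨0, x_sq_mem_typeFiber le_rfl⟩
  · exact ⟨1, x_mul_m_mem_typeFiber _⟩
  · exact ⟨0, od_N_subset_typeFiber n hg⟩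

theorem x_sq_mem_M2 (n : ℕ) : x n n ^ 2 ∈ M2 n := Subgroup.subset_closure (Or.inl (Or.inl rfl))

theorem x_mul_m_mem_M2 (n : ℕ) : x n n * m n ∈ M2 n :=
  Subgroup.subset_closure (Or.inl (Or.inr rfl))

/-- The `u ∈ W_n` such that `N_{n+1}` contains the element that acts as `u` on the left half of the
leaves and trivially on the right half. -/
def leftFactor (n : ℕ) : Subgroup (LeafPerm n) :=
  (N (n + 1)).comap ((nodeHom n).comp (MonoidHom.inl _ _))

theorem mem_leftFactor {u : LeafPerm n} : u ∈ leftFactor n ↔ node u 1 0 ∈ N (n + 1) := Iff.rfl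

theorem node_mem_N {u v : LeafPerm n} (hu : u ∈ leftFactor n) (hv : v ∈ leftFactor n) :
    node u v 0 ∈ N (n + 1) := by
  have hright := conj_mem_N (x_mem_M (n + 1)) (mem_leftFactor.1 hv)
  simp only [x_succ_self, node_one_inv, node_one_mul, mul_one, one_mul, mul_inv_cancel, inv_one,
    add_zero, fin_two_add_self] at hright
  simpa only [node_zero_mul, mul_one, one_mul] using mul_mem (mem_leftFactor.1 hu) hright

theorem typeFiber_subset_M2 (h : evenTypedGroup n ≤ leftFactor n) :
    typeFiber (n + 1) 0 ⊆ M2 (n + 1) := by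
  have hod {u v : LeafPerm n} (hu : u ∈ evenTypedGroup n) (hv : v ∈ evenTypedGroup n)
      (huv : node u v 0 ∈ typeFiber (n + 1) 0) : node u v 0 ∈ M2 (n + 1) := by
    have hx : x (n + 1) (n + 1) * node u v 0 ∈ typeFiber (n + 1) (1, 1) :=
      mul_mem_typeFiber (x_mem_typeFiber _) huv
    exact Subgroup.subset_closure (Or.inr ⟨node_mem_N (h hu) (h hv), typeFiber_subset_treeAut hx,
      sameCycle_of_mem_typeFiber hx⟩)
  intro g hg
  obtain ⟨u, v, ⟨p, q⟩, Q, hu, hv, hT, rfl⟩ := id hg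
  obtain rfl : Q = (p, q) := by
    rw [← add_left_cancel_iff (a := (p, q)), hT, type_add_self]; rfl
  obtain rfl | rfl := fin_two_eq_zero_or_one q
  · exact hod ⟨p, hu⟩ ⟨p, hv⟩ hg
  · have hxg := mul_mem_typeFiber (inv_mem_typeFiber (x_sq_mem_typeFiber (le_refl (n + 1)))) hg
    have hx := inv_mem_typeFiber (x_mem_typeFiber n)
    rw [x_sq_succ_self, node_zero_inv] at hxg
    change node _ _ 0 * node u v 0 ∈ _ at hxg
    rw [node_zero_mul] at hxg
    have := mul_mem (x_sq_mem_M2 (n + 1))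
      (hod ⟨_, mul_mem_typeFiber hx hu⟩ ⟨_, mul_mem_typeFiber hx hv⟩ hxg)
    rwa [x_sq_succ_self, node_zero_mul, mul_inv_cancel_left, mul_inv_cancel_left] at this

theorem evenTypedGroup_le_M2 (h : evenTypedGroup n ≤ leftFactor n) :
    evenTypedGroup (n + 1) ≤ M2 (n + 1) := by
  rintro g ⟨s, hg⟩
  obtain rfl | rfl := fin_two_eq_zero_or_one s
  · exact typeFiber_subset_M2 h hg
  · have hxmg := mul_mem_typeFiber (inv_mem_typeFiber (x_mul_m_mem_typeFiber (n + 1))) hg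
    simpa only [mul_inv_cancel_left] using
      mul_mem (x_mul_m_mem_M2 (n + 1)) (typeFiber_subset_M2 h hxmg)

theorem x_mem_normalizer_leftFactor (n : ℕ) : x n n ∈ Subgroup.normalizer (leftFactor n) := by
  have hx : node (x n n) (x n n) 0 ∈ Subgroup.normalizer (N (n + 1)) := by
    rw [← x_sq_succ_self]
    exact M_le_normalizer_N _ (pow_mem (x_mem_M _) 2)
  intro u
  have := Subgroup.mem_normalizer_iff.1 hx (node u 1 0)
  rwa [node_zero_inv, node_zero_mul, node_zero_mul, mul_one, mul_inv_cancel] at this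

theorem mLeft_mem_leftFactor (n : ℕ) : mLeft n ∈ leftFactor n := by
  rw [mem_leftFactor, ← m_succ]
  exact H_le_N _ (m_mem_H _)

theorem x_sq_mem_leftFactor {i : ℕ} (hi : 2 ≤ i) (hin : i ≤ n) : x n i ^ 2 ∈ leftFactor n := by
  rw [mem_leftFactor, ← x_sq_succ_of_le hin]
  exact H_le_N _ (x_sq_mem_H hi (Nat.lt_succ_of_le hin))

theorem x_self_sq_mem_leftFactor : (n : ℕ) → x n n ^ 2 ∈ leftFactor n
  | 0 => one_mem _
  | 1 => by
    rw [x_sq_succ_self]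
    exact node_one_one_zero (n := 0) ▸ one_mem _
  | _ + 2 => x_sq_mem_leftFactor (Nat.le_add_left 2 _) le_rfl

theorem mLeft_mul_x : (n : ℕ) → mLeft n * x n n = x n n ^ 2 * m n
  | 0 => rfl
  | n + 1 => by
    rw [x_sq_succ_self, m_succ, mLeft, x_succ_self, node_one_mul, node_zero_mul, mul_one, one_mul,
      mul_one, fin_two_add_self]

theorem x_mul_m_mem_leftFactor (n : ℕ) : x n n * m n ∈ leftFactor n := by
  have := (Subgroup.mem_normalizer_iff''.1 (x_mem_normalizer_leftFactor n) (mLeft n)).1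
    (mLeft_mem_leftFactor n)
  rwa [mul_assoc, mLeft_mul_x, sq, mul_assoc, inv_mul_cancel_left] at this

theorem mem_or_mul_mem_of_mem_closure {G : Type*} [Group G] {K : Subgroup G} {y g : G} {S : Set G}
    (hy : y ∈ Subgroup.normalizer K) (hy2 : y ^ 2 ∈ K) (hS : ∀ s ∈ S, s ∈ K ∨ y * s ∈ K)
    (hg : g ∈ Subgroup.closure S) : g ∈ K ∨ y * g ∈ K := by
  have hS' : Subgroup.closure S ≤ Subgroup.zpowers y ⊔ K := by
    rw [Subgroup.closure_le]
    intro s hs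
    obtain h | h := hS s hs
    · exact Subgroup.mem_sup_right h
    · rw [← inv_mul_cancel_left y s]
      exact mul_mem (Subgroup.mem_sup_left (inv_mem (Subgroup.mem_zpowers y)))
        (Subgroup.mem_sup_right h)
  have hg' : g ∈ ((Subgroup.zpowers y ⊔ K : Subgroup G) : Set G) := hS' hg
  rw [Subgroup.coe_mul_of_left_le_normalizer_right _ _ (Subgroup.zpowers_le.2 hy)] at hg'
  obtain ⟨_, ⟨z, rfl⟩, k, hk, rfl⟩ := hg'
  have hzpow (j : ℤ) : y ^ (2 * j) * k ∈ K :=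
    mul_mem (zpow_mul y 2 j ▸ zpow_mem (zpow_ofNat y 2 ▸ hy2) j) hk
  obtain ⟨j, rfl | rfl⟩ := Int.even_or_odd' z
  · exact Or.inl (hzpow j)
  · refine Or.inr ?_
    have := hzpow (j + 1)
    rwa [show 2 * (j + 1) = 1 + (2 * j + 1) by ring, zpow_one_add, mul_assoc] at this

theorem mem_leftFactor_or_of_mem_M {g : LeafPerm n} (hg : g ∈ M n) :
    g ∈ leftFactor n ∨ x n n * g ∈ leftFactor n := by
  refine mem_or_mul_mem_of_mem_closure (x_mem_normalizer_leftFactor n) (x_self_sq_mem_leftFactor n)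
    ?_ hg
  rintro g ((rfl | rfl) | ⟨i, hi, rfl⟩)
  · exact Or.inr (sq (x n n) ▸ x_self_sq_mem_leftFactor n)
  · exact Or.inr (x_mul_m_mem_leftFactor n)
  · exact Or.inl (x_sq_mem_leftFactor (by omega) (by omega))

theorem mem_leftFactor_of_x_mul_mem {g : LeafPerm n} (hg : g ∈ evenTypedGroup n)
    (hxg : x n n * g ∈ leftFactor n) : g ∈ leftFactor n := by
  obtain ⟨s, hg⟩ := hg
  obtain _ | _ | n := n
  · obtain rfl : g = 1 := hg
    exact one_mem _
  · have hx : x (0 + 1) (0 + 1) = mLeft (0 + 1) := x_succ_self 0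
    rw [hx] at hxg
    exact (Subgroup.mul_mem_cancel_left _ (mLeft_mem_leftFactor (0 + 1))).1 hxg
  · obtain ⟨⟨w, w'⟩, ⟨⟨s', hw⟩, -⟩, hww⟩ := N_succ_le _ (mem_leftFactor.1 hxg)
    obtain ⟨rfl, -⟩ := node_inj.1 (show node w w' 0 = node (x _ _ * g) 1 0 from hww)
    have := snd_eq_of_mem_typeFiber hw (mul_mem_typeFiber (x_mem_typeFiber _) hg)
    simp at this

theorem M2_eq_evenTypedGroup (n : ℕ) : M2 (n + 1) = evenTypedGroup (n + 1) := by
  refine le_antisymm (M2_succ_le n) (evenTypedGroup_le_M2 ?_)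
  induction n with
  | zero =>
    rintro u ⟨s, rfl⟩
    exact one_mem _
  | succ n ih =>
    intro u hu
    exact (mem_leftFactor_or_of_mem_M (M2_le_M _ (evenTypedGroup_le_M2 ih hu))).elim id
      (mem_leftFactor_of_x_mul_mem hu)

end groups

/-! ## Cycle types through minimal periods -/

section periods

variable {α : Type*}

/-- The multiset in which each `d ∈ S` is repeated `d` times: it lists the minimal periods of the
points that lie on cycles with lengths `S`. -/
def repeated (S : Multiset ℕ) : Multiset ℕ := S.bind fun d => Multiset.replicate d d

theorem repeated_add (S T : Multiset ℕ) : repeated (S + T) = repeated S + repeated T :=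
  Multiset.add_bind _ _ _

theorem repeated_singleton (d : ℕ) : repeated {d} = Multiset.replicate d d :=
  Multiset.singleton_bind _ _

theorem count_repeated (S : Multiset ℕ) (d : ℕ) : (repeated S).count d = d * S.count d := by
  induction S using Multiset.induction_on with
  | empty => rfl
  | cons e S ih =>
    rw [← Multiset.singleton_add, repeated_add, repeated_singleton, Multiset.count_add,
      Multiset.count_add, ih, mul_add, Multiset.count_replicate, Multiset.count_singleton]
    simp only [mul_ite, mul_one, mul_zero, eq_comm (a := d)]
    split_ifs with h
    · rw [h]
    · rfl

theorem repeated_replicate_one (k : ℕ) :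
    repeated (Multiset.replicate k 1) = Multiset.replicate k 1 := by
  induction k with
  | zero => rfl
  | succ k ih =>
    rw [Multiset.replicate_succ, ← Multiset.singleton_add, repeated_add, ih, repeated_singleton]
    rfl

theorem repeated_map_two_mul (S : Multiset ℕ) :
    repeated (S.map (2 * ·)) = (repeated S).map (2 * ·) + (repeated S).map (2 * ·) := by
  rw [repeated, repeated, Multiset.map_bind, Multiset.bind_map, ← Multiset.bind_add]
  refine Multiset.bind_congr fun d _ => ?_
  rw [Multiset.map_replicate, ← Multiset.replicate_add, two_mul]

theorem repeated_inj {S T : Multiset ℕ} (hS : ∀ d ∈ S, 0 < d) (hT : ∀ d ∈ T, 0 < d) :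
    repeated S = repeated T ↔ S = T := by
  refine ⟨fun h => ?_, congrArg repeated⟩
  ext d
  obtain rfl | hd := Nat.eq_zero_or_pos d
  · rw [Multiset.count_eq_zero.2 fun h0 => (hS 0 h0).false,
      Multiset.count_eq_zero.2 fun h0 => (hT 0 h0).false]
  · have := congrArg (Multiset.count d) h
    rw [count_repeated, count_repeated] at this
    exact Nat.eq_of_mul_eq_mul_left hd this

theorem isPeriodicPt_iff (g : Equiv.Perm α) (i : α) (k : ℕ) :
    Function.IsPeriodicPt g k i ↔ (g ^ k) i = i := by
  rw [Function.IsPeriodicPt, Function.IsFixedPt, Equiv.Perm.iterate_eq_pow]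

theorem minimalPeriod_eq_of_forall {g : Equiv.Perm α} {i : α} {d : ℕ}
    (h : ∀ k, (g ^ k) i = i ↔ d ∣ k) : Function.minimalPeriod g i = d :=
  Nat.dvd_right_iff_eq.1 fun k => by
    rw [← h, ← isPeriodicPt_iff, Function.isPeriodicPt_iff_minimalPeriod_dvd]

theorem minimalPeriod_mul_of_fixed {g h : Equiv.Perm α} (hgh : Commute g h) {i : α} (hi : h i = i) :
    Function.minimalPeriod (g * h : Equiv.Perm α) i = Function.minimalPeriod g i := by
  refine Function.minimalPeriod_eq_minimalPeriod_iff.2 fun k => ?_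
  rw [isPeriodicPt_iff, isPeriodicPt_iff, hgh.mul_pow, Equiv.Perm.mul_apply,
    Equiv.Perm.pow_apply_eq_self_of_apply_eq_self hi]

variable [Fintype α]

/-- The multiset of the minimal periods of all points. -/
noncomputable def periods (g : Equiv.Perm α) : Multiset ℕ := ∑ i, {Function.minimalPeriod g i}

variable [DecidableEq α]

theorem minimalPeriod_of_mem_support {g : Equiv.Perm α} (hg : g.IsCycle) {i : α}
    (hi : i ∈ g.support) : Function.minimalPeriod g i = g.support.card :=
  minimalPeriod_eq_of_forall fun k => by
    rw [← hg.orderOf, orderOf_dvd_iff_pow_eq_one, hg.pow_eq_one_iff' (Equiv.Perm.mem_support.1 hi)]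

theorem sum_support_minimalPeriod (g : Equiv.Perm α) :
    ∑ i ∈ g.support, ({Function.minimalPeriod g i} : Multiset ℕ) = repeated g.cycleType := by
  induction g using Equiv.Perm.cycle_induction_on with
  | base_one => simp [repeated]
  | base_cycles g hg =>
    rw [Finset.sum_congr rfl fun i hi => by rw [minimalPeriod_of_mem_support hg hi],
      Finset.sum_const, hg.cycleType, repeated_singleton, Multiset.nsmul_singleton]
  | induction_disjoint g h hd _ ihg ihh =>
    rw [hd.support_mul, Finset.sum_union hd.disjoint_support, hd.cycleType_mul, repeated_add, ← ihg,
      ← ihh]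
    congr 1
    · refine Finset.sum_congr rfl fun i hi => ?_
      rw [minimalPeriod_mul_of_fixed hd.commute]
      exact (hd i).resolve_left (Equiv.Perm.mem_support.1 hi)
    · refine Finset.sum_congr rfl fun i hi => ?_
      rw [hd.commute.eq, minimalPeriod_mul_of_fixed hd.commute.symm]
      exact (hd i).resolve_right (Equiv.Perm.mem_support.1 hi)

theorem periods_eq_repeated_parts (g : Equiv.Perm α) : periods g = repeated g.partition.parts := by
  have hfix : ∀ i ∈ g.supportᶜ, ({Function.minimalPeriod g i} : Multiset ℕ) = {1} := by
    intro i hi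
    rw [Finset.mem_compl, Equiv.Perm.notMem_support] at hi
    rw [Function.minimalPeriod_eq_one_iff_isFixedPt.2 hi]
  rw [periods, Equiv.Perm.parts_partition, repeated_add, ← sum_support_minimalPeriod,
    ← Finset.sum_add_sum_compl g.support, Finset.sum_congr rfl hfix, Finset.sum_const,
    Finset.card_compl, Multiset.nsmul_singleton, repeated_replicate_one]

end periods

section cycleTypeFull

variable {n : ℕ} (u v : LeafPerm n)

theorem cycleTypeFull_pos {g : LeafPerm n} {d : ℕ} (hd : d ∈ cycleTypeFull g) : 0 < d :=
  g.partition.parts_pos hd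

theorem periods_eq_repeated (g : LeafPerm n) : periods g = repeated (cycleTypeFull g) :=
  periods_eq_repeated_parts g

theorem periods_eq_sum_halves (g : LeafPerm (n + 1)) :
    periods g = ∑ i, {Function.minimalPeriod g (halves n (0, i))} +
      ∑ i, {Function.minimalPeriod g (halves n (1, i))} := by
  rw [periods, ← (halves n).sum_comp, Fintype.sum_prod_type, Fin.sum_univ_two]

theorem node_zero_pow (k : ℕ) : node u v 0 ^ k = node (u ^ k) (v ^ k) 0 :=
  (map_pow (nodeHom n) (u, v) k).symm

theorem node_one_pow_two_mul (k : ℕ) :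
    node u v 1 ^ (2 * k) = node ((u * v) ^ k) ((v * u) ^ k) 0 := by
  rw [pow_mul, sq, node_one_mul, fin_two_add_self, node_zero_pow]

theorem minimalPeriod_node_zero_left (i : Fin (2 ^ n)) :
    Function.minimalPeriod (node u v 0) (halves n (0, i)) = Function.minimalPeriod u i :=
  Function.minimalPeriod_eq_minimalPeriod_iff.2 fun k => by
    simp [isPeriodicPt_iff, node_zero_pow, node_zero_apply_zero]

theorem minimalPeriod_node_zero_right (i : Fin (2 ^ n)) :
    Function.minimalPeriod (node u v 0) (halves n (1, i)) = Function.minimalPeriod v i :=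
  Function.minimalPeriod_eq_minimalPeriod_iff.2 fun k => by
    simp [isPeriodicPt_iff, node_zero_pow, node_zero_apply_one]

theorem minimalPeriod_node_one_left (i : Fin (2 ^ n)) :
    Function.minimalPeriod (node u v 1) (halves n (0, i)) =
      2 * Function.minimalPeriod (u * v : LeafPerm n) i := by
  refine minimalPeriod_eq_of_forall fun k => ?_
  obtain ⟨j, rfl | rfl⟩ := Nat.even_or_odd' k
  · rw [node_one_pow_two_mul, node_zero_apply_zero, Nat.mul_dvd_mul_iff_left two_pos,
      ← Function.isPeriodicPt_iff_minimalPeriod_dvd, isPeriodicPt_iff]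
    simp
  · rw [pow_succ' (node u v 1), node_one_pow_two_mul, Equiv.Perm.mul_apply, node_zero_apply_zero,
      node_one_apply_zero]
    refine iff_of_false (fun h => by simp at h) fun h => ?_
    exact Nat.not_even_two_mul_add_one j (even_iff_two_dvd.2 (dvd_of_mul_right_dvd h))

theorem minimalPeriod_node_one_right (i : Fin (2 ^ n)) :
    Function.minimalPeriod (node u v 1) (halves n (1, i)) =
      2 * Function.minimalPeriod (u * v : LeafPerm n) (u i) := by
  rw [← minimalPeriod_node_one_left, ← node_one_apply_one u v,
    Function.minimalPeriod_apply ((node u v 1).injective.mem_periodicPts _)]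

theorem cycleTypeFull_node_zero :
    cycleTypeFull (node u v 0) = cycleTypeFull u + cycleTypeFull v := by
  refine (repeated_inj (fun _ => cycleTypeFull_pos) fun d hd => ?_).1 ?_
  · exact (Multiset.mem_add.1 hd).elim cycleTypeFull_pos cycleTypeFull_pos
  · rw [repeated_add, ← periods_eq_repeated, ← periods_eq_repeated, ← periods_eq_repeated,
      periods_eq_sum_halves]
    simp only [minimalPeriod_node_zero_left, minimalPeriod_node_zero_right, periods]

theorem cycleTypeFull_node_one :
    cycleTypeFull (node u v 1) = (cycleTypeFull (u * v)).map (2 * ·) := by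
  refine (repeated_inj (fun _ => cycleTypeFull_pos) fun d hd => ?_).1 ?_
  · obtain ⟨e, he, rfl⟩ := Multiset.mem_map.1 hd
    exact mul_pos two_pos (cycleTypeFull_pos he)
  · have hmap : (periods (u * v)).map (2 * ·) =
        ∑ i, ({2 * Function.minimalPeriod (u * v : LeafPerm n) i} : Multiset ℕ) := by
      rw [periods, ← Multiset.coe_mapAddMonoidHom, map_sum]
      simp only [Multiset.coe_mapAddMonoidHom, Multiset.map_singleton]
    rw [repeated_map_two_mul, ← periods_eq_repeated, ← periods_eq_repeated, periods_eq_sum_halves,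
      hmap]
    simp only [minimalPeriod_node_one_left, minimalPeriod_node_one_right]
    rw [Equiv.sum_comp u fun i =>
      ({2 * Function.minimalPeriod (u * v : LeafPerm n) i} : Multiset ℕ)]

end cycleTypeFull

/-! ## Average cycle types -/

section average

open Finset
open scoped BigOperators

section cover

variable {ι α R : Type*} [DecidableEq α] {s : Finset ι} {t : ι → Finset α} {u : Finset α} {k : ℕ}

theorem sum_sum_of_uniform_cover [AddCommMonoid R] (ht : ∀ i ∈ s, t i ⊆ u)
    (hu : ∀ y ∈ u, #{i ∈ s | y ∈ t i} = k) (f : α → R) :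
    ∑ i ∈ s, ∑ y ∈ t i, f y = k • ∑ y ∈ u, f y := by
  rw [sum_comm' (t' := u) (s' := fun y => {i ∈ s | y ∈ t i}), smul_sum]
  · exact sum_congr rfl fun y hy => by rw [sum_const, hu y hy]
  · intro i y
    rw [mem_filter]
    exact ⟨fun h => ⟨h, ht i h.1 h.2⟩, And.left⟩

theorem expect_of_uniform_cover [AddCommMonoid R] [Module ℚ≥0 R] {N : ℕ} (hk : k ≠ 0)
    (ht : ∀ i ∈ s, t i ⊆ u) (hN : ∀ i ∈ s, #(t i) = N) (hu : ∀ y ∈ u, #{i ∈ s | y ∈ t i} = k)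
    (f : α → R) : 𝔼 y ∈ u, f y = 𝔼 i ∈ s, 𝔼 y ∈ t i, f y := by
  have card_eq : #s * N = k * #u := by
    simpa [sum_congr rfl hN] using sum_sum_of_uniform_cover ht hu fun _ => (1 : ℕ)
  have expect_t : ∀ i ∈ s, 𝔼 y ∈ t i, f y = (N : ℚ≥0)⁻¹ • ∑ y ∈ t i, f y := fun i hi => by
    rw [expect, hN i hi]
  rw [expect_congr rfl expect_t, expect, expect, ← smul_sum, sum_sum_of_uniform_cover ht hu,
    ← Nat.cast_smul_eq_nsmul ℚ≥0, smul_smul, smul_smul, ← mul_inv, ← Nat.cast_mul, card_eq,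
    Nat.cast_mul, mul_inv_rev, inv_mul_cancel_right₀ (Nat.cast_ne_zero.2 hk)]

end cover

variable {n : ℕ} {T T' : Fin 2 × Fin 2}

theorem typeFiber_nonempty (n : ℕ) (T : Fin 2 × Fin 2) : (typeFiber n T).Nonempty := by
  obtain ⟨s, t⟩ := T
  obtain rfl | rfl := fin_two_eq_zero_or_one s <;> obtain rfl | rfl := fin_two_eq_zero_or_one t
  exacts [⟨1, one_mem_typeFiber n⟩, ⟨m n, m_mem_typeFiber n⟩, ⟨mLeft n, mLeft_mem_typeFiber n⟩,
    ⟨x n n, x_mem_typeFiber n⟩]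

open Classical in
/-- `typeFiber n T` as a finite set. -/
noncomputable def typeFinset (n : ℕ) (T : Fin 2 × Fin 2) : Finset (LeafPerm n) :=
  {g | g ∈ typeFiber n T}

theorem mem_typeFinset {g : LeafPerm n} : g ∈ typeFinset n T ↔ g ∈ typeFiber n T := by
  simp [typeFinset]

theorem typeFinset_nonempty (n : ℕ) (T : Fin 2 × Fin 2) : (typeFinset n T).Nonempty :=
  (typeFiber_nonempty n T).imp fun _ => mem_typeFinset.2

theorem mul_mem_typeFinset_iff {g h : LeafPerm n} (hg : g ∈ typeFinset n T) :
    g * h ∈ typeFinset n (T + T') ↔ h ∈ typeFinset n T' := by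
  simp only [mem_typeFinset] at hg ⊢
  refine ⟨fun hgh => ?_, mul_mem_typeFiber hg⟩
  have := mul_mem_typeFiber (inv_mem_typeFiber hg) hgh
  rwa [inv_mul_cancel_left, ← add_assoc, type_add_self, zero_add] at this

theorem mem_typeFinset_add_iff {g : LeafPerm n} (hg : g ∈ typeFinset n T) :
    g ∈ typeFinset n (T + T') ↔ 1 ∈ typeFinset n T' := by
  simpa only [mul_one] using mul_mem_typeFinset_iff (h := 1) hg

theorem card_typeFinset (n : ℕ) (T : Fin 2 × Fin 2) : #(typeFinset n T) = #(typeFinset n 0) := by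
  obtain ⟨g, hg⟩ := typeFinset_nonempty n T
  refine (card_equiv (Equiv.mulLeft g) fun h => ?_).symm
  rw [Equiv.coe_mulLeft, ← mul_mem_typeFinset_iff hg, add_zero]

theorem expect_typeFinset_mul_left {R : Type*} [AddCommMonoid R] [Module ℚ≥0 R] {g : LeafPerm n}
    (hg : g ∈ typeFinset n T) (T' : Fin 2 × Fin 2) (f : LeafPerm n → R) :
    𝔼 h ∈ typeFinset n T', f (g * h) = 𝔼 h ∈ typeFinset n (T + T'), f h :=
  expect_equiv (Equiv.mulLeft g) (fun _ => (mul_mem_typeFinset_iff hg).symm) fun _ _ => rfl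

theorem card_common_types {P Q : Fin 2 × Fin 2} {u v : LeafPerm n} (hu : u ∈ typeFinset n P)
    (hv : v ∈ typeFinset n Q) :
    #{R | u ∈ typeFinset n R ∧ v ∈ typeFinset n (R + (P + Q))} = #{R | 1 ∈ typeFinset n R} := by
  refine (card_equiv (Equiv.addLeft P) fun R => ?_).symm
  have hR : P + R + (P + Q) = Q + R := by
    rw [add_add_add_comm, type_add_self, zero_add, add_comm]
  simp only [mem_filter_univ, Equiv.coe_addLeft, hR, mem_typeFinset_add_iff hu,
    mem_typeFinset_add_iff hv, and_self]

theorem node_mem_typeFinset_iff {u v : LeafPerm n} :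
    node u v T.1 ∈ typeFinset (n + 1) T ↔
      ∃ P Q, u ∈ typeFinset n P ∧ v ∈ typeFinset n Q ∧ P + Q = T.swap := by
  simp only [mem_typeFinset]
  refine ⟨?_, fun ⟨P, Q, hu, hv, hT⟩ => node_mem_typeFiber hu hv hT⟩
  rintro ⟨u, v, P, Q, hu, hv, hT, huv⟩
  obtain ⟨rfl, rfl, -⟩ := node_inj.1 huv
  exact ⟨P, Q, hu, hv, hT⟩

theorem expect_typeFinset_eq_expect_node {R : Type*} [AddCommMonoid R] [Module ℚ≥0 R]
    (T : Fin 2 × Fin 2) (f : LeafPerm (n + 1) → R) :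
    𝔼 g ∈ typeFinset (n + 1) T, f g =
      𝔼 p : LeafPerm n × LeafPerm n with node p.1 p.2 T.1 ∈ typeFinset (n + 1) T,
        f (node p.1 p.2 T.1) := by
  symm
  refine expect_nbij (g := f) (fun p => node p.1 p.2 T.1) (fun p hp => ?_) (fun _ _ => rfl) ?_ ?_
  · rwa [mem_filter_univ] at hp
  · exact fun p _ q _ hpq => Prod.ext (node_inj.1 hpq).1 (node_inj.1 hpq).2.1
  · intro g hg
    obtain ⟨u, v, -, -, -, -, -, rfl⟩ := mem_typeFinset.1 hg
    exact ⟨(u, v), by simpa using hg, rfl⟩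

theorem expect_typeFinset_succ {R : Type*} [AddCommMonoid R] [Module ℚ≥0 R]
    (T : Fin 2 × Fin 2) (f : LeafPerm (n + 1) → R) :
    𝔼 g ∈ typeFinset (n + 1) T, f g =
      𝔼 P, 𝔼 u ∈ typeFinset n P, 𝔼 v ∈ typeFinset n (P + T.swap), f (node u v T.1) := by
  rw [expect_typeFinset_eq_expect_node,
    expect_of_uniform_cover (s := univ)
      (t := fun P => typeFinset n P ×ˢ typeFinset n (P + T.swap))
      (N := #(typeFinset n 0) * #(typeFinset n 0)) (k := #{P | 1 ∈ typeFinset n P})]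
  · exact expect_congr rfl fun P _ => expect_product' _ _ fun u v => f (node u v T.1)
  · exact card_ne_zero_of_mem ((mem_filter_univ _).2 (mem_typeFinset.2 (one_mem_typeFiber n)))
  · intro P _ p hp
    rw [mem_product] at hp
    rw [mem_filter_univ, node_mem_typeFinset_iff]
    refine ⟨_, _, hp.1, hp.2, ?_⟩
    rw [← add_assoc, type_add_self, zero_add]
  · intro P _
    rw [card_product, card_typeFinset n P, card_typeFinset n (P + T.swap)]
  · intro p hp
    rw [mem_filter_univ, node_mem_typeFinset_iff] at hp
    obtain ⟨P, Q, hu, hv, hT⟩ := hp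
    simpa only [mem_product, hT] using card_common_types hu hv

/-- Rational combinations of cycle types; the product takes disjoint unions of cycle types. -/
abbrev CycleAlgebra := AddMonoidAlgebra ℚ (Multiset ℕ)

/-- The cycle type of `g` as an element of the cycle algebra. -/
noncomputable def cycleMonomial (g : LeafPerm n) : CycleAlgebra := .single (cycleTypeFull g) 1

/-- The doubling of all cycle lengths. The scalars are those of `Finset.expect`. -/
noncomputable def doubling : CycleAlgebra →ₐ[ℚ≥0] CycleAlgebra :=
  AddMonoidAlgebra.mapDomainAlgHom ℚ≥0 ℚ (Multiset.mapAddMonoidHom (2 * ·))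

theorem doubling_single (c : Multiset ℕ) (r : ℚ) :
    doubling (.single c r) = .single (c.map (2 * ·)) r := by
  simp [doubling]

theorem cycleMonomial_node_zero (u v : LeafPerm n) :
    cycleMonomial (node u v 0) = cycleMonomial u * cycleMonomial v := by
  rw [cycleMonomial, cycleMonomial, cycleMonomial, AddMonoidAlgebra.single_mul_single,
    cycleTypeFull_node_zero, one_mul]

theorem cycleMonomial_node_one (u v : LeafPerm n) :
    cycleMonomial (node u v 1) = doubling (cycleMonomial (u * v)) := by
  rw [cycleMonomial, cycleMonomial, doubling_single, cycleTypeFull_node_one]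

/-- The average cycle type of the elements of `W_n` of type `T`. -/
noncomputable def average (n : ℕ) (T : Fin 2 × Fin 2) : CycleAlgebra :=
  𝔼 g ∈ typeFinset n T, cycleMonomial g

theorem average_zero (T : Fin 2 × Fin 2) : average 0 T = .single {1} 1 := by
  have typeFinset_zero : typeFinset 0 T = {1} := by
    ext g
    rw [mem_typeFinset, mem_singleton]
    rfl
  have cycleTypeFull_one : cycleTypeFull (1 : LeafPerm 0) = {1} := by
    refine (repeated_inj (fun _ => cycleTypeFull_pos) (by simp)).1 ?_
    rw [← periods_eq_repeated, repeated_singleton]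
    simp [periods]
  rw [average, typeFinset_zero, expect_singleton, cycleMonomial, cycleTypeFull_one]

theorem average_succ_zero (n : ℕ) (t : Fin 2) :
    average (n + 1) (0, t) = 𝔼 P, average n P * average n (P + (t, 0)) := by
  simp only [average, expect_typeFinset_succ, Prod.swap_prod_mk, cycleMonomial_node_zero,
    expect_mul_expect]

theorem average_succ_one (n : ℕ) (t : Fin 2) :
    average (n + 1) (1, t) = doubling (average n (t, 1)) := by
  have expect_sections : ∀ P, ∀ u ∈ typeFinset n P,
      𝔼 v ∈ typeFinset n (P + (t, 1)), cycleMonomial (node u v 1) =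
        doubling (average n (t, 1)) := fun P u hu => by
    simp only [cycleMonomial_node_one, ← map_expect]
    rw [expect_typeFinset_mul_left hu _ cycleMonomial, ← add_assoc, type_add_self, zero_add,
      average]
  calc average (n + 1) (1, t)
      = 𝔼 P, 𝔼 u ∈ typeFinset n P, 𝔼 v ∈ typeFinset n (P + (t, 1)),
          cycleMonomial (node u v 1) := expect_typeFinset_succ _ _
    _ = 𝔼 P : Fin 2 × Fin 2, 𝔼 _u ∈ typeFinset n P, doubling (average n (t, 1)) :=
        expect_congr rfl fun P _ => expect_congr rfl (expect_sections P)
    _ = doubling (average n (t, 1)) := by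
        simp only [expect_const, typeFinset_nonempty, univ_nonempty]

theorem groupCycleDensity_eq_coeff (G : Subgroup (LeafPerm n)) [DecidablePred (· ∈ G)]
    (c : Multiset ℕ) : groupCycleDensity G c = (𝔼 g with g ∈ G, cycleMonomial g).coeff c := by
  have card_G : Nat.card G = #{g | g ∈ G} := Nat.subtype_card _ fun g => mem_filter_univ g
  have card_cycleType : Nat.card {g : LeafPerm n // g ∈ G ∧ cycleTypeFull g = c} =
      #{g ∈ ({g | g ∈ G} : Finset _) | cycleTypeFull g = c} :=
    Nat.subtype_card _ fun g => by rw [mem_filter, mem_filter_univ]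
  rw [groupCycleDensity, card_G, card_cycleType, expect, card_filter, div_eq_inv_mul]
  simp [cycleMonomial, Finsupp.single_apply, NNRat.smul_def]

theorem groupCycleDensity_M2 (n : ℕ) (c : Multiset ℕ) :
    groupCycleDensity (M2 (n + 1)) c = (𝔼 s, average (n + 1) (s, 0)).coeff c := by
  classical
  have mem_M2 {g : LeafPerm (n + 1)} : g ∈ M2 (n + 1) ↔ ∃ s, g ∈ typeFinset (n + 1) (s, 0) := by
    simp only [M2_eq_evenTypedGroup, mem_evenTypedGroup, mem_typeFinset]
  rw [groupCycleDensity_eq_coeff,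
    expect_of_uniform_cover (s := univ) (t := fun s => typeFinset (n + 1) (s, 0)) one_ne_zero]
  · rfl
  · exact fun s _ g hg => (mem_filter_univ g).2 (mem_M2.2 ⟨s, hg⟩)
  · exact fun s _ => card_typeFinset (n + 1) (s, 0)
  · intro g hg
    obtain ⟨s, hs⟩ := mem_M2.1 ((mem_filter_univ g).1 hg)
    refine card_eq_one.2 ⟨s, ext fun s' => ?_⟩
    rw [mem_filter_univ, mem_singleton]
    exact ⟨fun hs' => fst_eq_of_mem_typeFiber (mem_typeFinset.1 hs') (mem_typeFinset.1 hs),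
      fun h => h ▸ hs⟩

end average

/-! ## The generating function of the Markov process -/

section generatingFunction

open Polynomial

variable (f : ℤ[X])

/-- The generating function of the cycle data of a collection of data. -/
noncomputable def genFun (A : Data) : CycleAlgebra :=
  (A.map fun D => .single (degrees D.1) D.2).sum

/-- The generating function of the cycle data that arise from a single factor in `k` steps. -/
noncomputable def factorGenFun : ℕ → Typ × ℕ → CycleAlgebra
  | 0, g => .single {g.2} 1
  | k + 1, g => ((childrenData f g).map fun C => C.2 • (C.1.map (factorGenFun k)).prod).sum

theorem coeff_genFun (A : Data) (c : Multiset ℕ) : (genFun A).coeff c = cycleDensity A c := by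
  induction A with
  | nil => simp [genFun, cycleDensity]
  | cons D A ih =>
    rw [genFun, List.map_cons, List.sum_cons, ← genFun, AddMonoidAlgebra.coeff_add,
      Finsupp.add_apply, ih, cycleDensity, cycleDensity, List.filter_cons]
    by_cases hD : degrees D.1 = c <;> simp [hD]

theorem prod_factorGenFun_zero (D : FactorizationType) :
    (D.map (factorGenFun f 0)).prod = .single (degrees D) 1 := by
  induction D with
  | nil => rfl
  | cons g D ih =>
    rw [List.map_cons, List.prod_cons, ih, factorGenFun, AddMonoidAlgebra.single_mul_single,
      one_mul]
    rfl

theorem sum_map_flatMap {α β R : Type*} [AddMonoid R] (l : List α) (F : α → List β) (G : β → R) :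
    ((l.flatMap F).map G).sum = (l.map fun i => ((F i).map G).sum).sum := by
  rw [List.map_flatMap, List.flatMap_def, List.sum_flatten, List.map_map]
  rfl

theorem sum_stepType (k : ℕ) (D : FactorizationType) :
    ((stepType f D).map fun E => E.2 • (E.1.map (factorGenFun f k)).prod).sum =
      (D.map (factorGenFun f (k + 1))).prod := by
  induction D with
  | nil => simp [stepType]
  | cons g D ih =>
    rw [stepType, sum_map_flatMap, List.map_cons, List.prod_cons, ← ih, factorGenFun,
      ← List.sum_map_mul_right]
    congr 1
    refine List.map_congr_left fun C _ => ?_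
    rw [← List.sum_map_mul_left, List.map_map]
    congr 1
    refine List.map_congr_left fun E _ => ?_
    simp only [Function.comp_apply, List.map_append, List.prod_append, smul_mul_smul_comm]

theorem genFun_iterate_stepData (k : ℕ) (A : Data) :
    genFun ((stepData f)^[k] A) = (A.map fun D => D.2 • (D.1.map (factorGenFun f k)).prod).sum := by
  induction k generalizing A with
  | zero => simp [genFun, prod_factorGenFun_zero]
  | succ k ih =>
    rw [Function.iterate_succ_apply, ih, stepData, sum_map_flatMap]
    congr 1
    refine List.map_congr_left fun D _ => ?_
    rw [← sum_stepType, List.map_map, List.smul_sum, List.map_map]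
    congr 1
    refine List.map_congr_left fun E _ => ?_
    simp only [Function.comp_apply, mul_smul]

theorem factorGenFun_succ_n (k : ℕ) (T : Typ) (d : ℕ) :
    factorGenFun f (k + 1) (.n :: T, d) = factorGenFun f k (actTyp f (.n :: T), 2 * d) := by
  simp [factorGenFun, childrenData, childrenOptions]

theorem factorGenFun_succ_s (k : ℕ) (T : Typ) (d : ℕ) :
    factorGenFun f (k + 1) (.s :: T, d) = ((allowablePairs f (.s :: T)).length : ℚ)⁻¹ •
      ((allowablePairs f (.s :: T)).map fun P =>
        factorGenFun f k (P.1, d) * factorGenFun f k (P.2, d)).sum := by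
  simp [factorGenFun, childrenData, childrenOptions, List.smul_sum, Function.comp_def]

end generatingFunction

/-! ## The critical orbit of `h_a` -/

section criticalOrbit

open Polynomial

variable (a : ℤ)

theorem aeval_h (y : ℚ) : aeval y (h a) = (y + a) ^ 2 - a - 1 := by
  simp [h]

theorem criticalPoint_h : criticalPoint (h a) = -a := by
  have h_expand : h a = C 1 * X ^ 2 + C (2 * a) * X + C (a ^ 2 - a - 1) := by
    simp only [h, map_mul, map_sub, map_pow, map_one, map_ofNat]
    ring
  have coeff_one : (h a).coeff 1 = 2 * a := by
    rw [h_expand, coeff_add, coeff_add, coeff_C_mul_X_pow, coeff_C_mul_X, coeff_C]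
    simp
  have coeff_two : (h a).coeff 2 = 1 := by
    rw [h_expand, coeff_add, coeff_add, coeff_C_mul_X_pow, coeff_C_mul_X, coeff_C]
    simp
  rw [criticalPoint, coeff_one, coeff_two]
  push_cast
  ring

theorem criticalIterate_h (k : ℕ) :
    criticalIterate (h a) k = if Even k then -(a : ℚ) else -a - 1 := by
  induction k with
  | zero => simp [criticalIterate, criticalPoint_h]
  | succ k ih =>
    rw [criticalIterate, Function.iterate_succ_apply', ← criticalIterate, ih, aeval_h]
    by_cases hk : Even k
    · simp [hk, Nat.even_add_one]
    · simp only [hk, Nat.even_add_one, if_false, not_false_eq_true, if_true]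
      ring

theorem postCriticalOrbit_h : postCriticalOrbit (h a) = {-(a : ℚ) - 1, -(a : ℚ)} := by
  ext y
  simp only [postCriticalOrbit, Set.mem_ofPred_eq, criticalIterate_h, Set.mem_insert_iff,
    Set.mem_singleton_iff]
  constructor
  · rintro ⟨k, -, rfl⟩
    split_ifs <;> simp
  · rintro (rfl | rfl)
    · exact ⟨1, le_rfl, by simp⟩
    · exact ⟨2, one_le_two, by simp⟩

theorem orbitSize_h : orbitSize (h a) = 2 := by
  rw [orbitSize, postCriticalOrbit_h, Set.ncard_pair]
  exact (sub_one_lt _).ne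

theorem tailSize_h : tailSize (h a) = 0 := by
  have postCriticalTail_h : postCriticalTail (h a) = ∅ := by
    rw [Set.eq_empty_iff_forall_notMem]
    rintro y ⟨k, -, -, hk⟩
    refine hk (k + 2) (by omega) ?_
    simp [criticalIterate_h, Nat.even_add]
  rw [tailSize, postCriticalTail_h, Set.ncard_empty]

theorem siblingIndex_h : siblingIndex (h a) = 2 := by
  rw [siblingIndex, if_pos (tailSize_h a), orbitSize_h]

theorem returnIndex_h : returnIndex (h a) = 1 := by
  rw [returnIndex, orbitSize_h]
  refine le_antisymm (Nat.sInf_le ⟨le_rfl, ?_⟩) (le_csInf ⟨1, le_rfl, ?_⟩ fun k hk => hk.1)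
  all_goals simp [criticalIterate_h, Nat.even_add_one]

end criticalOrbit

/-! ## Model 6 and the average cycle types -/

section model

open Finset
open scoped BigOperators

variable (a : ℤ) (k : ℕ)

/-- The letters of `T`, with `0` and `1` standing for `s` and `n`. -/
def toTyp (T : Fin 2 × Fin 2) : Typ := [![.s, .n] T.1, ![.s, .n] T.2]

theorem actTyp_h_toTyp (T : Fin 2 × Fin 2) : actTyp (h a) (toTyp T) = toTyp T.swap := by
  rw [actTyp, returnIndex_h]
  rfl

theorem allowablePairs_h (t : Fin 2) :
    (allowablePairs (h a) (toTyp (0, t)) : Multiset (Typ × Typ)) =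
      (univ : Finset (Fin 2 × Fin 2)).val.map fun P => (toTyp P, toTyp (P + (t, 0))) := by
  rw [allowablePairs, orbitSize_h, siblingIndex_h, actTyp_h_toTyp]
  revert t
  decide

theorem factorGenFun_succ_zero (t : Fin 2) (d : ℕ) :
    factorGenFun (h a) (k + 1) (toTyp (0, t), d) =
      𝔼 P, factorGenFun (h a) k (toTyp P, d) * factorGenFun (h a) k (toTyp (P + (t, 0)), d) := by
  have toTyp_zero : toTyp (0, t) = .s :: [![.s, .n] t] := rfl
  rw [toTyp_zero, factorGenFun_succ_s, ← toTyp_zero, ← Multiset.coe_card, ← Multiset.sum_coe,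
    ← Multiset.map_coe, allowablePairs_h, Multiset.card_map, Multiset.map_map, expect,
    ← NNRat.cast_smul_eq_nnqsmul ℚ, NNRat.cast_inv, NNRat.cast_natCast]
  rfl

theorem factorGenFun_succ_one (t : Fin 2) (d : ℕ) :
    factorGenFun (h a) (k + 1) (toTyp (1, t), d) = factorGenFun (h a) k (toTyp (t, 1), 2 * d) := by
  have toTyp_one : toTyp (1, t) = .n :: [![.s, .n] t] := rfl
  rw [toTyp_one, factorGenFun_succ_n, ← toTyp_one, actTyp_h_toTyp, Prod.swap_prod_mk]

theorem factorGenFun_two_mul (T : Fin 2 × Fin 2) (d : ℕ) :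
    factorGenFun (h a) k (toTyp T, 2 * d) = doubling (factorGenFun (h a) k (toTyp T, d)) := by
  induction k generalizing T d with
  | zero => rw [factorGenFun, factorGenFun, doubling_single, Multiset.map_singleton]
  | succ k ih =>
    obtain ⟨s, t⟩ := T
    obtain rfl | rfl := fin_two_eq_zero_or_one s
    · simp only [factorGenFun_succ_zero, map_expect, map_mul, ih]
    · rw [factorGenFun_succ_one, factorGenFun_succ_one, ih]

theorem factorGenFun_eq_average (T : Fin 2 × Fin 2) :
    factorGenFun (h a) k (toTyp T, 1) = average k T := by
  induction k generalizing T with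
  | zero => rw [factorGenFun, average_zero]
  | succ k ih =>
    obtain ⟨s, t⟩ := T
    obtain rfl | rfl := fin_two_eq_zero_or_one s
    · simp only [factorGenFun_succ_zero, average_succ_zero, ih]
    · rw [factorGenFun_succ_one, average_succ_one, factorGenFun_two_mul, ih]

theorem genFun_model6 :
    genFun (levelData (h a) model6 (k + 1)) = 𝔼 s, average (k + 1) (s, 0) := by
  have average_one_zero : average (k + 1) (1, 0) = factorGenFun (h a) k (toTyp (0, 1), 2) := by
    rw [average_succ_one, ← factorGenFun_eq_average a, ← factorGenFun_two_mul]
  have average_zero_zero : average (k + 1) (0, 0) = 𝔼 P, factorGenFun (h a) k (toTyp P, 1) ^ 2 := by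
    rw [average_succ_zero]
    refine expect_congr rfl fun P _ => ?_
    rw [factorGenFun_eq_average, sq, ← Prod.zero_eq_mk, add_zero]
  rw [levelData, Nat.add_sub_cancel, genFun_iterate_stepData, expect_univ, Fin.sum_univ_two,
    average_zero_zero, average_one_zero]
  simp only [expect_univ, ← NNRat.cast_smul_eq_nnqsmul ℚ, Fintype.sum_prod_type, Fin.sum_univ_two,
    Fintype.card_prod, Fintype.card_fin, NNRat.cast_inv, NNRat.cast_natCast, model6, toTyp,
    List.map_cons, List.map_nil, List.prod_cons, List.prod_nil, List.sum_cons, List.sum_nil,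
    Matrix.cons_val_zero, Matrix.cons_val_one, sq, mul_one]
  module

end model

end MarkovModel

theorem corollary6p28_general (a : ℤ) (n : ℕ) (hn : 1 ≤ n) :
    MarkovModel.SatisfiesEvenMarkovModel (MarkovModel.h a) MarkovModel.model6 n
      (MarkovModel.M2 n) := by
  obtain ⟨k, rfl⟩ := Nat.exists_eq_add_of_le' hn
  refine ⟨?_, fun c => ?_⟩
  · exact (MarkovModel.M2_succ_le k).trans (MarkovModel.evenTypedGroup_le_treeAut (k + 1))
  · rw [MarkovModel.groupCycleDensity_M2, ← MarkovModel.coeff_genFun, MarkovModel.genFun_model6]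

theorem corollary6p28 (a : ℤ) (ha : ∃ b : ℤ, a = b ^ 2 ∨ a = -b ^ 2)
    (hirr : Irreducible (MarkovModel.h a)) (n : ℕ) (hn : 1 ≤ n) :
    MarkovModel.SatisfiesEvenMarkovModel (MarkovModel.h a) MarkovModel.model6 n
      (MarkovModel.M2 n) :=
  corollary6p28_general a n hn
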